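/- Let $p=\{p_x\}_{x\in\mathbb N}$, $\mathbb N=\{0,1,2,\dots\}$, be a decreasing probability mass function: $p_x\ge p_{x+1}\ge 0$ and $\sum_x p_x=1$. Let $Y=\{Y_x\}_{x\in\mathbb N}$ be a Gaussian process with mean zero and $\mathrm{Cov}(Y_x,Y_z)=p_x\delta_{x,z}-p_xp_z$ (its paths are almost surely in $\ell_2$). For a vector $w=(w_0,\dots,w_k)$ let $\mathrm{gren}(w)$ be the vector of the $k+1$ slopes of the least concave majorant of the points $(j,\sum_{i=0}^{j}w_i)$, $j=-1,0,\dots,k$, where the empty sum is $0$. Define $Y^G$ by $(Y^G_r,\dots,Y^G_s)=\mathrm{gren}(Y_r,\dots,Y_s)$ for every maximal finite interval $\{r,\dots,s\}$ on which $p$ is constant, and $Y^G_x=Y_x$ at every $x$ that lies in no such finite interval (then $p_x=0$ and $Y_x=0$ almost surely). Write $p$ in terms of its intervals of constancy: $p_x=\theta_i$ for $x\in C_i$, where the nonempty sets $C_1,C_2,\dots$ (finitely or infinitely many) form a partition of $\mathbb N$ and $\theta_i>\theta_{i+1}$ for all $i$. Then: 1. Almost surely $\sum_{x\ge0}(Y^G_x)^2<\infty$,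 this sum is integrable, and $$E\Big[\sum_{x\ge 0}(Y^G_x)^2\Big]=\sum_{i\ge1}\sum_{j=1}^{|C_i|}\theta_i\Big(\frac1j-\theta_i\Big).$$ (If $C_i$ is infinite then $\theta_i=0$ and its term is $0$.) 2. If $\kappa=\max\{x:p_x>0\}$ exists, i.e. the support is finite, then $\sum_{x=0}^\kappa (Y^G_x)^2/p_x$ is integrable and $$E\Big[\sum_{x=0}^{\kappa}\frac{(Y^G_x)^2}{p_x}\Big]=\sum_{i\,:\,\theta_i>0}\ \sum_{j=1}^{|C_i|}\Big(\frac1j-\theta_i\Big).$$ 3. For $y\in\mathbb N$ let $p$ be the uniform mass function on $\{0,\dots,y\}$, let $\widehat p_n$ be the empirical mass function of an i.i.d. sample $X_1,\dots,X_n$ from $p$, and let $\widehat p_n^{\,G}$ be the maximum likelihood (Grenander) estimator of a decreasing mass function, that is, $\mathrm{gren}(\widehat p_{n,0},\dots,\widehat p_{n,M})$ with $M=\max_i X_i$, extended by zero. Then $$\lim_{n\to\infty} n\,E\Big[\sum_{x\ge0}(\widehat p^{\,G}_{n,x}-p_x)^2\Big]=E\Big[\sum_{x\ge0}(Y^G_x)^2\Big]=a_y:=\frac1{y+1}\sum_{i=1}^{y}\frac1{i+1},$$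 and $a_y\sim (\log y)/(y+1)$ as $y\to\infty$. -/

import Mathlib

open MeasureTheory ProbabilityTheory Filter Topology Asymptotics

noncomputable section

/-- `p` is a decreasing probability mass function on `ℕ`. -/
structure IsDecreasingPMF (p : ℕ → ℝ) : Prop where
  nonneg : ∀ x, 0 ≤ p x
  hasSum_one : HasSum p 1
  antitone : Antitone p

/-- `p` takes the value `θ i` on `C i`, where the sets `C i`, `i ∈ I`, partition `ℕ` and the
values are strictly decreasing in `i`. The index set `I` is an initial segment of `ℕ`: all of `ℕ`
if `p` takes infinitely many values, and `{0, …, m - 1}` if it takes `m` values. -/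
structure IsConstancyDecomposition (p : ℕ → ℝ) (I : Set ℕ) (C : ℕ → Set ℕ) (θ : ℕ → ℝ) :
    Prop where
  isLowerSet : IsLowerSet I
  nonempty : ∀ i ∈ I, (C i).Nonempty
  disjoint : I.PairwiseDisjoint C
  cover : ⋃ i ∈ I, C i = Set.univ
  value : ∀ i ∈ I, ∀ x ∈ C i, p x = θ i
  strictAnti : ∀ i, i + 1 ∈ I → θ (i + 1) < θ i

/-- `Y` is a centred Gaussian process indexed by `ℕ` with covariance
`Cov(Y_x, Y_z) = p_x δ_{x,z} - p_x p_z`, the limit of the fluctuations of the empirical mass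
function. As `∑ₓ Var(Y_x) = ∑ₓ p_x (1 - p_x)` is finite, its paths are almost surely in `ℓ²`. -/
structure IsLimitProcess {Ω : Type*} [MeasurableSpace Ω] (p : ℕ → ℝ) (Y : ℕ → Ω → ℝ)
    (P : Measure Ω) : Prop where
  gaussian : IsGaussianProcess Y P
  mean : ∀ x, ∫ ω, Y x ω ∂P = 0
  cov : ∀ x z, cov[Y x, Y z; P] = (if x = z then p x else 0) - p x * p z

/-- The least concave majorant on `[0, n]` of the points `(m, S m)`, `m = 0, …, n`: the pointwise
infimum of all functions that are concave on `[0, n]` and lie above these points. -/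
def leastConcaveMajorant (n : ℕ) (S : ℕ → ℝ) (t : ℝ) : ℝ :=
  sInf {v : ℝ | ∃ g : ℝ → ℝ, ConcaveOn ℝ (Set.Icc (0 : ℝ) n) g ∧
    (∀ m : ℕ, m ≤ n → S m ≤ g m) ∧ v = g t}

/-- The operator `gren`, applied to the vector `(w 0, …, w (n - 1))`: its `j`-th entry, `j < n`, is
the slope between `j` and `j + 1` of the least concave majorant of the partial sums
`(m, w 0 + ⋯ + w (m - 1))`, `m = 0, …, n` (which is linear there). -/
def gren (n : ℕ) (w : ℕ → ℝ) (j : ℕ) : ℝ :=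
  leastConcaveMajorant n (fun m ↦ ∑ i ∈ Finset.range m, w i) ((j : ℝ) + 1) -
    leastConcaveMajorant n (fun m ↦ ∑ i ∈ Finset.range m, w i) (j : ℝ)

/-- The period of constancy of `p` that contains `x`; it is an interval when `p` is monotone. -/
def constancyPeriod (p : ℕ → ℝ) (x : ℕ) : Set ℕ := {z | p z = p x}

open Classical in
/-- The transform `y ↦ y^G` of a path `y`: on each finite period of constancy `{r, …, s}` of `p`
the vector `(y r, …, y s)` is replaced by its image under `gren`. An infinite period of constancy
(the set of zeros of `p`, if there are any) is left unchanged. -/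
def grenTransform (p : ℕ → ℝ) (y : ℕ → ℝ) (x : ℕ) : ℝ :=
  if (constancyPeriod p x).Finite then
    gren (sSup (constancyPeriod p x) + 1 - sInf (constancyPeriod p x))
      (fun i ↦ y (sInf (constancyPeriod p x) + i)) (x - sInf (constancyPeriod p x))
  else y x

/-- The uniform mass function on `{0, …, y}`. -/
def uniformMass (y : ℕ) (x : ℕ) : ℝ := if x ≤ y then 1 / ((y : ℝ) + 1) else 0

/-- The empirical mass function of a sample of size `n`. -/
def empiricalMass {n : ℕ} (X : Fin n → ℕ) (x : ℕ) : ℝ :=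
  (∑ i, if X i = x then (1 : ℝ) else 0) / n

/-- The maximum likelihood (Grenander) estimator of a decreasing mass function: `gren` of the
empirical mass function on `{0, …, max X_i}`, and zero beyond. -/
def grenanderEstimator {n : ℕ} (X : Fin n → ℕ) (x : ℕ) : ℝ :=
  if x ≤ Finset.univ.sup X then gren (Finset.univ.sup X + 1) (empiricalMass X) x else 0

/-- The distribution on `ℕ` with mass function `p`. -/
def massLaw (p : ℕ → ℝ) : Measure ℕ :=
  Measure.sum fun x ↦ ENNReal.ofReal (p x) • Measure.dirac x

/-- The `ℓ²` risk `E_p ∑ₓ (p̂ₙ,ₓ - pₓ)²` of the Grenander estimator for an i.i.d. sample of size `n`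
from `p`. -/
def grenanderRisk (p : ℕ → ℝ) (n : ℕ) : ℝ :=
  ∫ X : Fin n → ℕ, ∑' x, (grenanderEstimator X x - p x) ^ 2 ∂Measure.pi fun _ ↦ massLaw p

end

/-!
By Kac's identity, the maximum of the partial sums `0, S 1, …, S n` of a vector and the sum of
`max (S j) 0 / j` over `1 ≤ j ≤ n` have the same average over the permutations of its entries. The
sum of the positive parts of the slopes of the least concave majorant is the maximal partial sum.
Subtracting a level `t` from the entries lowers every slope by `t`, so the sums of `(gren w j - t)⁺`
and of `(S j / j - t)⁺` have the same permutation average for every `t`. As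
`u ^ 2 = 2 * ∫ t in -c..c, (u - t)⁺ - 2 * c * (u + c)⁺ + c ^ 2` for `|u| ≤ c`, the same holds for
the sums of squares. Therefore `∑ E (gren X)_j² = ∑ E (S_j / j)²` for an exchangeable vector `X`,
which reduces both expectations to the variances of partial sums. The limit process is exchangeable
on each period of constancy, because a Gaussian law is determined by its covariance, and the centred
empirical mass function of a uniform sample is exchangeable with `1 / n` times the same variances.
-/

section LeastConcaveMajorant

variable {n : ℕ} {S S' : ℕ → ℝ} {t : ℝ}

theorem leastConcaveMajorant_le {g : ℝ → ℝ} (hg : ConcaveOn ℝ (Set.Icc (0 : ℝ) n) g)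
    (hSg : ∀ m ≤ n, S m ≤ g m) (ht : t ∈ Set.Icc (0 : ℝ) n) :
    leastConcaveMajorant n S t ≤ g t := by
  refine csInf_le ⟨min (S 0) (S n), ?_⟩ ⟨g, hg, hSg, rfl⟩
  rintro _ ⟨f, hf, hSf, rfl⟩
  exact (min_le_min (by simpa using hSf 0 n.zero_le) (hSf n le_rfl)).trans
    (hf.min_le_of_mem_Icc (Set.left_mem_Icc.2 n.cast_nonneg) (Set.right_mem_Icc.2 n.cast_nonneg) ht)

theorem le_leastConcaveMajorant_of_forall {c : ℝ}
    (h : ∀ g : ℝ → ℝ, ConcaveOn ℝ (Set.Icc (0 : ℝ) n) g → (∀ m ≤ n, S m ≤ g m) → c ≤ g t) :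
    c ≤ leastConcaveMajorant n S t :=
  le_csInf ⟨_, fun _ ↦ partialSups S n, concaveOn_const _ (convex_Icc _ _),
    fun _ hm ↦ le_partialSups_of_le S hm, rfl⟩ (by rintro _ ⟨g, hg, hSg, rfl⟩; exact h g hg hSg)

theorem le_leastConcaveMajorant {m : ℕ} (hm : m ≤ n) : S m ≤ leastConcaveMajorant n S m :=
  le_leastConcaveMajorant_of_forall fun _ _ hSg ↦ hSg m hm

theorem concaveOn_leastConcaveMajorant (n : ℕ) (S : ℕ → ℝ) :
    ConcaveOn ℝ (Set.Icc (0 : ℝ) n) (leastConcaveMajorant n S) := by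
  refine ⟨convex_Icc _ _, fun x hx y hy a b ha hb hab ↦ ?_⟩
  refine le_leastConcaveMajorant_of_forall fun g hg hSg ↦ ?_
  exact (add_le_add (smul_le_smul_of_nonneg_left (leastConcaveMajorant_le hg hSg hx) ha)
    (smul_le_smul_of_nonneg_left (leastConcaveMajorant_le hg hSg hy) hb)).trans
    (hg.2 hx hy ha hb hab)

theorem leastConcaveMajorant_le_const {c : ℝ} (h : ∀ m ≤ n, S m ≤ c)
    (ht : t ∈ Set.Icc (0 : ℝ) n) : leastConcaveMajorant n S t ≤ c :=
  leastConcaveMajorant_le (concaveOn_const c (convex_Icc _ _)) h ht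

theorem leastConcaveMajorant_le_linear {c : ℝ} (h : ∀ m ≤ n, S m ≤ c * m)
    (ht : t ∈ Set.Icc (0 : ℝ) n) : leastConcaveMajorant n S t ≤ c * t :=
  leastConcaveMajorant_le ((LinearMap.mulLeft ℝ c).concaveOn (convex_Icc _ _)) h ht

theorem leastConcaveMajorant_zero (n : ℕ) (h0 : S 0 = 0) : leastConcaveMajorant n S 0 = 0 := by
  have h0n : (0 : ℝ) ∈ Set.Icc (0 : ℝ) n := Set.left_mem_Icc.2 n.cast_nonneg
  refine le_antisymm ?_ (by simpa [h0] using le_leastConcaveMajorant (S := S) n.zero_le)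
  have hS : ∀ m ≤ n, S m ≤ partialSups S n * m := by
    rintro (_ | m) hm
    · simp [h0]
    · have h0_le : 0 ≤ partialSups S n := h0 ▸ le_partialSups_of_le S n.zero_le
      refine (le_partialSups_of_le S hm).trans (le_mul_of_one_le_right h0_le ?_)
      exact_mod_cast m.succ_pos
  simpa using leastConcaveMajorant_le_linear hS h0n

theorem leastConcaveMajorant_le_add {ε : ℝ} (h : ∀ m ≤ n, S m ≤ S' m + ε)
    (ht : t ∈ Set.Icc (0 : ℝ) n) :
    leastConcaveMajorant n S t ≤ leastConcaveMajorant n S' t + ε := by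
  rw [← sub_le_iff_le_add]
  refine le_leastConcaveMajorant_of_forall fun g hg hSg ↦ sub_le_iff_le_add.2 ?_
  exact leastConcaveMajorant_le (hg.add_const ε)
    (fun m hm ↦ (h m hm).trans (add_le_add_left (hSg m hm) ε)) ht

theorem abs_leastConcaveMajorant_sub_le {ε : ℝ} (h : ∀ m ≤ n, |S m - S' m| ≤ ε)
    (ht : t ∈ Set.Icc (0 : ℝ) n) :
    |leastConcaveMajorant n S t - leastConcaveMajorant n S' t| ≤ ε := by
  simp only [abs_sub_le_iff, sub_le_iff_le_add'] at h ⊢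
  exact ⟨leastConcaveMajorant_le_add (fun m hm ↦ (h m hm).1) ht,
    leastConcaveMajorant_le_add (fun m hm ↦ (h m hm).2) ht⟩

theorem leastConcaveMajorant_congr (h : ∀ m ≤ n, S m = S' m) (ht : t ∈ Set.Icc (0 : ℝ) n) :
    leastConcaveMajorant n S t = leastConcaveMajorant n S' t :=
  sub_eq_zero.1 (abs_nonpos_iff.1 (abs_leastConcaveMajorant_sub_le (by simp +contextual [h]) ht))

theorem continuous_leastConcaveMajorant (ht : t ∈ Set.Icc (0 : ℝ) n) :
    Continuous fun S : ℕ → ℝ ↦ leastConcaveMajorant n S t := by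
  refine continuous_iff_continuousAt.2 fun S ↦ tendsto_iff_dist_tendsto_zero.2 ?_
  have hsum : Continuous fun T : ℕ → ℝ ↦ ∑ m ∈ Finset.range (n + 1), |T m - S m| := by fun_prop
  refine squeeze_zero (fun _ ↦ dist_nonneg) (fun T ↦ ?_) (by simpa using hsum.tendsto S)
  refine abs_leastConcaveMajorant_sub_le (fun m hm ↦ ?_) ht
  exact Finset.single_le_sum (f := fun m ↦ |T m - S m|) (fun _ _ ↦ abs_nonneg _)
    (Finset.mem_range_succ_iff.2 hm)

theorem abs_leastConcaveMajorant_le {ε : ℝ} (h : ∀ m ≤ n, |S m| ≤ ε)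
    (ht : t ∈ Set.Icc (0 : ℝ) n) : |leastConcaveMajorant n S t| ≤ ε := by
  simp only [abs_le] at h ⊢
  refine ⟨le_leastConcaveMajorant_of_forall fun g hg hSg ↦ ?_,
    leastConcaveMajorant_le_const (fun m hm ↦ (h m hm).2) ht⟩
  refine le_trans (le_min ?_ ?_) (hg.min_le_of_mem_Icc (Set.left_mem_Icc.2 n.cast_nonneg)
    (Set.right_mem_Icc.2 n.cast_nonneg) ht)
  · simpa using (h 0 n.zero_le).1.trans (hSg 0 n.zero_le)
  · exact (h n le_rfl).1.trans (hSg n le_rfl)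

theorem leastConcaveMajorant_sub_linear (S : ℕ → ℝ) (c : ℝ) (ht : t ∈ Set.Icc (0 : ℝ) n) :
    leastConcaveMajorant n (fun m ↦ S m - c * m) t = leastConcaveMajorant n S t - c * t := by
  have hle (S : ℕ → ℝ) (c : ℝ) : leastConcaveMajorant n (fun m ↦ S m - c * m) t ≤
      leastConcaveMajorant n S t - c * t := by
    refine le_sub_iff_add_le.2 (le_leastConcaveMajorant_of_forall fun g hg hSg ↦ ?_)
    refine le_sub_iff_add_le.1 (leastConcaveMajorant_le (g := fun t ↦ g t - c * t)
      (hg.sub ((LinearMap.mulLeft ℝ c).convexOn (convex_Icc _ _))) (fun m hm ↦ ?_) ht)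
    exact sub_le_sub_right (hSg m hm) _
  refine le_antisymm (hle S c) ?_
  have hneg := hle (fun m ↦ S m - c * m) (-c)
  simp only [neg_mul, sub_neg_eq_add, sub_add_cancel] at hneg
  exact sub_le_iff_le_add.2 hneg

theorem monotoneOn_leastConcaveMajorant (hmax : ∀ m ≤ n, S m ≤ S n) :
    MonotoneOn (leastConcaveMajorant n S) (Set.Icc (0 : ℝ) n) := by
  intro x hx y hy hxy
  have hxn : leastConcaveMajorant n S x ≤ leastConcaveMajorant n S n :=
    (leastConcaveMajorant_le_const hmax hx).trans (le_leastConcaveMajorant le_rfl)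
  exact (le_min le_rfl hxn).trans ((concaveOn_leastConcaveMajorant n S).min_le_of_mem_Icc hx
    (Set.right_mem_Icc.2 n.cast_nonneg) ⟨hxy, hy.2⟩)

theorem leastConcaveMajorant_eq_min {N : ℕ} (hnN : n ≤ N) (hmax : ∀ m ≤ n, S m ≤ S n)
    (hconst : ∀ m, n ≤ m → S m = S n) (ht : t ∈ Set.Icc (0 : ℝ) N) :
    leastConcaveMajorant N S t = leastConcaveMajorant n S (min t n) := by
  have hnN' : (n : ℝ) ≤ N := by exact_mod_cast hnN
  have hn : (n : ℝ) ∈ Set.Icc (0 : ℝ) n := Set.right_mem_Icc.2 n.cast_nonneg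
  apply le_antisymm
  · have hmaps : (fun s : ℝ ↦ min s n) '' Set.Icc (0 : ℝ) N = Set.Icc (0 : ℝ) n := by
      refine Set.Subset.antisymm ?_ fun s hs ↦ ⟨s, ⟨hs.1, hs.2.trans hnN'⟩, min_eq_left hs.2⟩
      exact Set.image_subset_iff.2 fun s hs ↦ ⟨le_min hs.1 n.cast_nonneg, min_le_right _ _⟩
    have hcomp : ConcaveOn ℝ (Set.Icc (0 : ℝ) N)
        (leastConcaveMajorant n S ∘ fun s ↦ min s n) := by
      apply ConcaveOn.comp
      · exact hmaps ▸ concaveOn_leastConcaveMajorant n S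
      · exact (concaveOn_id (convex_Icc _ _)).inf (concaveOn_const _ (convex_Icc _ _))
      · exact hmaps ▸ monotoneOn_leastConcaveMajorant hmax
    refine leastConcaveMajorant_le hcomp (fun m _ ↦ ?_) ht
    rcases le_total m n with hm | hm
    · simpa [hm] using le_leastConcaveMajorant (S := S) hm
    · simpa [hm, hconst m hm] using le_leastConcaveMajorant (S := S) (le_refl n)
  · refine le_leastConcaveMajorant_of_forall fun g hg hSg ↦ ?_
    rcases le_total t n with htn | htn
    · rw [min_eq_left htn]
      exact leastConcaveMajorant_le (hg.subset (Set.Icc_subset_Icc_right hnN') (convex_Icc _ _))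
        (fun m hm ↦ hSg m (hm.trans hnN)) ⟨ht.1, htn⟩
    · rw [min_eq_right htn]
      refine (leastConcaveMajorant_le_const hmax hn).trans <|
        (le_min (hSg n hnN) (hconst N hnN ▸ hSg N le_rfl)).trans <|
        hg.min_le_of_mem_Icc ⟨n.cast_nonneg, hnN'⟩ ?_ ⟨htn, ht.2⟩
      exact Set.right_mem_Icc.2 N.cast_nonneg

end LeastConcaveMajorant

section Gren

variable {n : ℕ} {w w' : ℕ → ℝ} {j : ℕ}

theorem gren_eq (n : ℕ) (w : ℕ → ℝ) (j : ℕ) :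
    gren n w j = leastConcaveMajorant n (fun m ↦ ∑ i ∈ Finset.range m, w i) (j + 1 : ℕ) -
      leastConcaveMajorant n (fun m ↦ ∑ i ∈ Finset.range m, w i) j := by
  rw [gren, Nat.cast_add_one]

theorem natCast_mem_Icc {m : ℕ} (hm : m ≤ n) : (m : ℝ) ∈ Set.Icc (0 : ℝ) n :=
  ⟨m.cast_nonneg, by exact_mod_cast hm⟩

theorem gren_congr (h : ∀ i < n, w i = w' i) (hj : j < n) : gren n w j = gren n w' j := by
  have hS : ∀ m ≤ n, ∑ i ∈ Finset.range m, w i = ∑ i ∈ Finset.range m, w' i := fun m hm ↦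
    Finset.sum_congr rfl fun i hi ↦ h i ((Finset.mem_range.1 hi).trans_le hm)
  rw [gren_eq, gren_eq, leastConcaveMajorant_congr hS (natCast_mem_Icc hj),
    leastConcaveMajorant_congr hS (natCast_mem_Icc hj.le)]

theorem antitoneOn_gren (n : ℕ) (w : ℕ → ℝ) : AntitoneOn (gren n w) (Set.Iio n) := by
  refine antitoneOn_of_succ_le Set.ordConnected_Iio fun j _ _ hj ↦ ?_
  rw [Nat.succ_eq_succ, Nat.succ_eq_add_one, Set.mem_Iio] at hj
  have hslope := (concaveOn_leastConcaveMajorant n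
    fun m ↦ ∑ i ∈ Finset.range m, w i).slope_anti_adjacent (x := j) (y := (j + 1 : ℕ))
    (z := (j + 1 + 1 : ℕ)) (natCast_mem_Icc (by lia)) (natCast_mem_Icc hj) (by simp) (by simp)
  simpa [gren] using hslope

theorem sum_range_gren (n : ℕ) (w : ℕ → ℝ) (m : ℕ) :
    ∑ j ∈ Finset.range m, gren n w j =
      leastConcaveMajorant n (fun m ↦ ∑ i ∈ Finset.range m, w i) m := by
  simp only [gren_eq]
  rw [Finset.sum_range_sub fun m : ℕ ↦
    leastConcaveMajorant n (fun m ↦ ∑ i ∈ Finset.range m, w i) (m : ℝ), Nat.cast_zero,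
    leastConcaveMajorant_zero n (Finset.sum_range_zero w), sub_zero]

theorem gren_sub_const (w : ℕ → ℝ) (c : ℝ) (hj : j < n) :
    gren n (fun i ↦ w i - c) j = gren n w j - c := by
  have hS (m : ℕ) :
      ∑ i ∈ Finset.range m, (w i - c) = ∑ i ∈ Finset.range m, w i - c * m := by
    simp [Finset.sum_sub_distrib, mul_comm]
  simp only [gren_eq, hS]
  rw [leastConcaveMajorant_sub_linear _ c (natCast_mem_Icc hj),
    leastConcaveMajorant_sub_linear _ c (natCast_mem_Icc hj.le)]
  push_cast
  ring

theorem continuous_gren (hj : j < n) : Continuous fun w : ℕ → ℝ ↦ gren n w j := by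
  have hS : Continuous fun (w : ℕ → ℝ) (m : ℕ) ↦ ∑ i ∈ Finset.range m, w i := by fun_prop
  simp only [gren_eq]
  exact ((continuous_leastConcaveMajorant (natCast_mem_Icc hj)).comp hS).sub
    ((continuous_leastConcaveMajorant (natCast_mem_Icc hj.le)).comp hS)

theorem abs_gren_le (w : ℕ → ℝ) (hj : j < n) :
    |gren n w j| ≤ 2 * ∑ i ∈ Finset.range n, |w i| := by
  have hS : ∀ m ≤ n, |∑ i ∈ Finset.range m, w i| ≤ ∑ i ∈ Finset.range n, |w i| := fun m hm ↦
    (Finset.abs_sum_le_sum_abs _ _).trans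
      (Finset.sum_le_sum_of_subset_of_nonneg (Finset.range_mono hm) fun _ _ _ ↦ abs_nonneg _)
  rw [gren_eq, two_mul]
  exact (abs_sub _ _).trans (add_le_add (abs_leastConcaveMajorant_le hS (natCast_mem_Icc hj))
    (abs_leastConcaveMajorant_le hS (natCast_mem_Icc hj.le)))

theorem gren_eq_ite_of_eventually_zero {N : ℕ} (hnN : n ≤ N) (hw : ∀ i, 0 ≤ w i)
    (hzero : ∀ i, n ≤ i → w i = 0) (hj : j < N) :
    gren N w j = if j < n then gren n w j else 0 := by
  have hmax : ∀ m ≤ n, ∑ i ∈ Finset.range m, w i ≤ ∑ i ∈ Finset.range n, w i := fun m hm ↦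
    Finset.sum_le_sum_of_subset_of_nonneg (Finset.range_mono hm) fun i _ _ ↦ hw i
  have hconst (m : ℕ) (hm : n ≤ m) : ∑ i ∈ Finset.range m, w i = ∑ i ∈ Finset.range n, w i :=
    (Finset.sum_subset (Finset.range_mono hm) fun i _ hi ↦ hzero i (by simpa using hi)).symm
  rw [gren_eq, leastConcaveMajorant_eq_min hnN hmax hconst (natCast_mem_Icc hj),
    leastConcaveMajorant_eq_min hnN hmax hconst (natCast_mem_Icc hj.le), ← Nat.cast_min,
    ← Nat.cast_min]
  split_ifs with hjn
  · rw [gren_eq, min_eq_left hjn.le, min_eq_left hjn]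
  · rw [min_eq_right (by lia), min_eq_right (by lia), sub_self]

/-- The maximum of the partial sums `x 0 + ⋯ + x (m - 1)`, `m = 0, …, n`, including the empty one.
-/
noncomputable def maxPartialSum (x : ℕ → ℝ) (n : ℕ) : ℝ :=
  partialSups (fun m ↦ ∑ i ∈ Finset.range m, x i) n

theorem sum_range_le_maxPartialSum (x : ℕ → ℝ) {m : ℕ} (hm : m ≤ n) :
    ∑ i ∈ Finset.range m, x i ≤ maxPartialSum x n :=
  le_partialSups_of_le (fun m ↦ ∑ i ∈ Finset.range m, x i) hm

theorem maxPartialSum_le {x : ℕ → ℝ} {c : ℝ} (h : ∀ m ≤ n, ∑ i ∈ Finset.range m, x i ≤ c) :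
    maxPartialSum x n ≤ c :=
  partialSups_le _ _ _ h

theorem maxPartialSum_zero (x : ℕ → ℝ) : maxPartialSum x 0 = 0 := by
  simp [maxPartialSum]

theorem maxPartialSum_nonneg (x : ℕ → ℝ) (n : ℕ) : 0 ≤ maxPartialSum x n := by
  simpa using sum_range_le_maxPartialSum x n.zero_le

theorem maxPartialSum_succ (x : ℕ → ℝ) (n : ℕ) :
    maxPartialSum x (n + 1) = max (maxPartialSum x n) (∑ i ∈ Finset.range (n + 1), x i) :=
  partialSups_add_one _ n

theorem sum_range_posPart_of_antitoneOn {u : ℕ → ℝ} (hu : AntitoneOn u (Set.Iio n)) :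
    ∑ j ∈ Finset.range n, (u j)⁺ = maxPartialSum u n := by
  induction n with
  | zero => simp [maxPartialSum_zero]
  | succ n ih =>
    have ih := ih (hu.mono (Set.Iio_subset_Iio n.le_succ))
    rw [maxPartialSum_succ, Finset.sum_range_succ, Finset.sum_range_succ]
    rcases le_total (u n) 0 with hn | hn
    · have hle := sum_range_le_maxPartialSum u (le_refl n)
      rw [posPart_eq_zero.2 hn, ih, add_zero, max_eq_left (by linarith)]
    · have hpos : ∑ j ∈ Finset.range n, (u j)⁺ = ∑ j ∈ Finset.range n, u j := by
        refine Finset.sum_congr rfl fun j hj ↦ posPart_eq_self.2 (hn.trans (hu ?_ ?_ ?_))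
        all_goals grind
      rw [posPart_eq_self.2 hn, ← ih, hpos, max_eq_right (by linarith)]

theorem maxPartialSum_gren (n : ℕ) (w : ℕ → ℝ) :
    maxPartialSum (gren n w) n = maxPartialSum w n := by
  apply le_antisymm
  · refine maxPartialSum_le fun m hm ↦ ?_
    rw [sum_range_gren]
    exact leastConcaveMajorant_le_const (fun k hk ↦ sum_range_le_maxPartialSum w hk)
      (natCast_mem_Icc hm)
  · refine maxPartialSum_le fun m hm ↦ ?_
    refine le_trans ?_ (sum_range_le_maxPartialSum (gren n w) hm)
    rw [sum_range_gren]
    exact le_leastConcaveMajorant (S := fun m ↦ ∑ i ∈ Finset.range m, w i) hm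

theorem sum_range_posPart_gren_sub (n : ℕ) (w : ℕ → ℝ) (t : ℝ) :
    ∑ j ∈ Finset.range n, (gren n w j - t)⁺ = maxPartialSum (fun i ↦ w i - t) n := by
  rw [← maxPartialSum_gren, ← sum_range_posPart_of_antitoneOn (antitoneOn_gren n _)]
  exact Finset.sum_congr rfl fun j hj ↦ by rw [gren_sub_const w t (Finset.mem_range.1 hj)]

end Gren

section Permutations

/-- The group of permutations of `ℕ` that fix every `i ≥ n`. It stands for the symmetric group on
`n` letters and acts on sequences, of which it rearranges the first `n` entries. -/
abbrev permBelow (n : ℕ) : Subgroup (Equiv.Perm ℕ) := fixingSubgroup (Equiv.Perm ℕ) (Set.Ici n)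

theorem mem_permBelow_iff {n : ℕ} {σ : Equiv.Perm ℕ} : σ ∈ permBelow n ↔ ∀ i, n ≤ i → σ i = i :=
  mem_fixingSubgroup_iff _

noncomputable instance (n : ℕ) : Fintype (permBelow n) :=
  Fintype.ofEquiv (Equiv.Perm (Fin n)) <|
    (Fin.equivSubtype.permCongr.trans (Equiv.Perm.subtypeEquivSubtypePerm (· < n))).trans <|
    Equiv.subtypeEquivRight fun σ ↦ by simp [mem_permBelow_iff]

theorem apply_lt_of_mem_permBelow {n : ℕ} {σ : Equiv.Perm ℕ} (hσ : σ ∈ permBelow n) {i : ℕ}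
    (hi : i < n) : σ i < n := by
  by_contra! h
  exact absurd (σ.injective (mem_permBelow_iff.1 hσ (σ i) h)) (by lia)

theorem permBelow_mono : Monotone permBelow := fun _ _ hmn ↦
  fixingSubgroup_antitone _ _ (Set.Ici_subset_Ici.2 hmn)

theorem sum_range_comp_of_mem_permBelow {n : ℕ} {τ : Equiv.Perm ℕ} (hτ : τ ∈ permBelow n)
    (x : ℕ → ℝ) : ∑ i ∈ Finset.range n, x (τ i) = ∑ i ∈ Finset.range n, x i := by
  refine τ.sum_comp _ x fun i hi ↦ ?_
  by_contra h
  exact hi (mem_permBelow_iff.1 hτ i (by simpa using h))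

theorem sum_subgroup_comp {ι α M : Type*} [AddCommMonoid M] {G : Subgroup (Equiv.Perm ι)}
    [Fintype G] {τ : Equiv.Perm ι} (hτ : τ ∈ G) (F : (ι → α) → M) (x : ι → α) :
    ∑ σ : G, F (fun i ↦ x (σ.1 (τ i))) = ∑ σ : G, F (fun i ↦ x (σ.1 i)) :=
  Equiv.sum_comp (Equiv.mulRight (⟨τ, hτ⟩ : G)) fun σ : G ↦ F fun i ↦ x (σ.1 i)

variable {m n : ℕ}

theorem sum_perm_ite_comp (hmn : m ≤ n) {τ : Equiv.Perm ℕ} (hτ : τ ∈ permBelow m)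
    (F : (ℕ → ℝ) → ℝ) (x : ℕ → ℝ) :
    ∑ σ : permBelow n,
        (if 0 < ∑ i ∈ Finset.range m, x (σ.1 i) then F fun i ↦ x (σ.1 (τ i)) else 0) =
      ∑ σ : permBelow n,
        if 0 < ∑ i ∈ Finset.range m, x (σ.1 i) then F fun i ↦ x (σ.1 i) else 0 := by
  rw [← sum_subgroup_comp (permBelow_mono hmn hτ)
    (fun y ↦ if 0 < ∑ i ∈ Finset.range m, y i then F y else 0) x]
  refine Finset.sum_congr rfl fun σ _ ↦ ?_
  rw [sum_range_comp_of_mem_permBelow hτ fun i ↦ x (σ.1 i)]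

theorem sum_perm_ite_apply_zero (hmn : m < n) (x : ℕ → ℝ) :
    ∑ σ : permBelow n,
        (if 0 < ∑ i ∈ Finset.range (m + 1), x (σ.1 i) then x (σ.1 0) else 0) =
      ∑ σ : permBelow n, (∑ i ∈ Finset.range (m + 1), x (σ.1 i))⁺ / (m + 1) := by
  have hswap : ∀ k ∈ Finset.range (m + 1), ∑ σ : permBelow n,
      (if 0 < ∑ i ∈ Finset.range (m + 1), x (σ.1 i) then x (σ.1 k) else 0) =
      ∑ σ : permBelow n,
        if 0 < ∑ i ∈ Finset.range (m + 1), x (σ.1 i) then x (σ.1 0) else 0 := by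
    intro k hk
    have hmem : Equiv.swap 0 k ∈ permBelow (m + 1) := mem_permBelow_iff.2 fun i hi ↦
      Equiv.swap_apply_of_ne_of_ne (by lia) (by grind)
    simpa using sum_perm_ite_comp hmn hmem (fun y ↦ y 0) x
  have hpos (σ : permBelow n) : (∑ i ∈ Finset.range (m + 1), x (σ.1 i))⁺ =
      ∑ k ∈ Finset.range (m + 1),
        if 0 < ∑ i ∈ Finset.range (m + 1), x (σ.1 i) then x (σ.1 k) else 0 := by
    split_ifs with h
    · exact posPart_eq_self.2 h.le
    · rw [Finset.sum_const_zero, posPart_eq_zero.2 (not_lt.1 h)]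
  have hsum := Finset.sum_congr rfl hswap
  rw [Finset.sum_comm, Finset.sum_const, Finset.card_range, nsmul_eq_mul, Nat.cast_add_one]
    at hsum
  rw [← Finset.sum_div, Finset.sum_congr rfl fun σ _ ↦ hpos σ, hsum]
  field_simp

/-- The cycle `0 ↦ m`, `i + 1 ↦ i` for `i < m`, which moves the first of `m + 1` entries to the
end. -/
def firstToLast (m : ℕ) : Equiv.Perm ℕ where
  toFun k := if k = 0 then m else if k ≤ m then k - 1 else k
  invFun k := if k < m then k + 1 else if k = m then 0 else k
  left_inv k := by grind
  right_inv k := by grind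

theorem firstToLast_mem_permBelow (m : ℕ) : firstToLast m ∈ permBelow (m + 1) :=
  mem_permBelow_iff.2 fun i hi ↦ by simp only [firstToLast, Equiv.coe_fn_mk]; grind

theorem firstToLast_add_one {i : ℕ} (hi : i < m) : firstToLast m (i + 1) = i := by
  simp only [firstToLast, Equiv.coe_fn_mk]; grind

theorem maxPartialSum_congr {x x' : ℕ → ℝ} (h : ∀ i < n, x i = x' i) :
    maxPartialSum x n = maxPartialSum x' n := by
  have hS : ∀ m ≤ n, ∑ i ∈ Finset.range m, x i = ∑ i ∈ Finset.range m, x' i := fun m hm ↦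
    Finset.sum_congr rfl fun i hi ↦ h i ((Finset.mem_range.1 hi).trans_le hm)
  exact le_antisymm (maxPartialSum_le fun m hm ↦ hS m hm ▸ sum_range_le_maxPartialSum x' hm)
    (maxPartialSum_le fun m hm ↦ hS m hm ▸ sum_range_le_maxPartialSum x hm)

theorem maxPartialSum_succ' (x : ℕ → ℝ) (n : ℕ) :
    maxPartialSum x (n + 1) = max 0 (x 0 + maxPartialSum (fun i ↦ x (i + 1)) n) := by
  induction n with
  | zero => simp [maxPartialSum_succ, maxPartialSum_zero]
  | succ n ih =>
    rw [maxPartialSum_succ, ih, Finset.sum_range_succ', maxPartialSum_succ, max_assoc,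
      ← max_add_add_left, add_comm _ (x 0)]

theorem maxPartialSum_succ_eq_ite (x : ℕ → ℝ) (m : ℕ) :
    maxPartialSum x (m + 1) = if 0 < ∑ i ∈ Finset.range (m + 1), x i
      then x 0 + maxPartialSum (fun i ↦ x (i + 1)) m else maxPartialSum x m := by
  split_ifs with h
  · rw [Finset.sum_range_succ'] at h
    have hle := sum_range_le_maxPartialSum (fun i ↦ x (i + 1)) (le_refl m)
    rw [maxPartialSum_succ', max_eq_right (by linarith)]
  · rw [maxPartialSum_succ, max_eq_left ((not_lt.1 h).trans (maxPartialSum_nonneg x m))]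

theorem sum_perm_maxPartialSum_succ (hmn : m < n) (x : ℕ → ℝ) :
    ∑ σ : permBelow n, maxPartialSum (fun i ↦ x (σ.1 i)) (m + 1) =
      ∑ σ : permBelow n, maxPartialSum (fun i ↦ x (σ.1 i)) m +
      ∑ σ : permBelow n, (∑ i ∈ Finset.range (m + 1), x (σ.1 i))⁺ / (m + 1) := by
  have hshift : ∑ σ : permBelow n, (if 0 < ∑ i ∈ Finset.range (m + 1), x (σ.1 i)
        then maxPartialSum (fun i ↦ x (σ.1 (i + 1))) m else 0) =
      ∑ σ : permBelow n, if 0 < ∑ i ∈ Finset.range (m + 1), x (σ.1 i)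
        then maxPartialSum (fun i ↦ x (σ.1 i)) m else 0 := by
    rw [← sum_perm_ite_comp hmn (firstToLast_mem_permBelow m)
      (fun y ↦ maxPartialSum (fun i ↦ y (i + 1)) m) x]
    refine Finset.sum_congr rfl fun σ _ ↦ ?_
    rw [maxPartialSum_congr fun i hi ↦ congrArg (fun k ↦ x (σ.1 k)) (firstToLast_add_one hi)]
  have hsplit (σ : permBelow n) : maxPartialSum (fun i ↦ x (σ.1 i)) (m + 1) =
      maxPartialSum (fun i ↦ x (σ.1 i)) m +
      (if 0 < ∑ i ∈ Finset.range (m + 1), x (σ.1 i) then x (σ.1 0) else 0) +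
      ((if 0 < ∑ i ∈ Finset.range (m + 1), x (σ.1 i)
        then maxPartialSum (fun i ↦ x (σ.1 (i + 1))) m else 0) -
      if 0 < ∑ i ∈ Finset.range (m + 1), x (σ.1 i)
        then maxPartialSum (fun i ↦ x (σ.1 i)) m else 0) := by
    rw [maxPartialSum_succ_eq_ite]
    split_ifs <;> ring
  rw [Finset.sum_congr rfl fun σ _ ↦ hsplit σ, Finset.sum_add_distrib, Finset.sum_add_distrib,
    Finset.sum_sub_distrib, hshift, sub_self, add_zero, sum_perm_ite_apply_zero hmn]

/-- **Kac's identity**, the combinatorial core of Spitzer's identity. -/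
theorem sum_perm_maxPartialSum (hmn : m ≤ n) (x : ℕ → ℝ) :
    ∑ σ : permBelow n, maxPartialSum (fun i ↦ x (σ.1 i)) m =
      ∑ σ : permBelow n, ∑ j ∈ Finset.range m,
        (∑ i ∈ Finset.range (j + 1), x (σ.1 i))⁺ / (j + 1) := by
  induction m with
  | zero => simp [maxPartialSum_zero]
  | succ m ih =>
    simp only [sum_perm_maxPartialSum_succ hmn, ih (Nat.le_of_succ_le hmn),
      Finset.sum_range_succ _ m, Finset.sum_add_distrib]

end Permutations

section PosPart

theorem intervalIntegral_posPart_sub {a b u : ℝ} (hu : u ∈ Set.Icc a b) :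
    ∫ t in a..b, (u - t)⁺ = (u - a) ^ 2 / 2 := by
  have hcont : Continuous fun t : ℝ ↦ (u - t)⁺ := by fun_prop
  have hleft : ∫ t in a..u, (u - t)⁺ = ∫ t in a..u, (u - t) := by
    refine intervalIntegral.integral_congr fun t ht ↦ posPart_eq_self.2 (sub_nonneg.2 ?_)
    exact (Set.uIcc_of_le hu.1 ▸ ht).2
  have hright : ∫ t in u..b, (u - t)⁺ = ∫ _ in u..b, (0 : ℝ) := by
    refine intervalIntegral.integral_congr fun t ht ↦ posPart_eq_zero.2 (sub_nonpos.2 ?_)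
    exact (Set.uIcc_of_le hu.2 ▸ ht).1
  rw [← intervalIntegral.integral_add_adjacent_intervals (b := u)
    (hcont.intervalIntegrable _ _) (hcont.intervalIntegrable _ _), hleft, hright,
    intervalIntegral.integral_sub (by simp) (by simp)]
  simp only [intervalIntegral.integral_const, integral_id, smul_eq_mul, mul_zero, add_zero]
  ring

theorem sum_sq_eq_of_sum_posPart_sub_eq {ι : Type*} (s : Finset ι) (u v : ι → ℝ)
    (h : ∀ t, ∑ i ∈ s, (u i - t)⁺ = ∑ i ∈ s, (v i - t)⁺) :
    ∑ i ∈ s, u i ^ 2 = ∑ i ∈ s, v i ^ 2 := by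
  obtain ⟨c, hc⟩ : ∃ c, ∀ i ∈ s, u i ∈ Set.Icc (-c) c ∧ v i ∈ Set.Icc (-c) c := by
    refine ⟨∑ i ∈ s, (|u i| + |v i|), fun i hi ↦ ?_⟩
    have hle := Finset.single_le_sum (f := fun i ↦ |u i| + |v i|) (fun i _ ↦ by positivity) hi
    exact ⟨abs_le.1 (by linarith [abs_nonneg (v i)]), abs_le.1 (by linarith [abs_nonneg (u i)])⟩
  have hlinear : ∑ i ∈ s, (u i - -c) = ∑ i ∈ s, (v i - -c) := by
    rw [← Finset.sum_congr rfl fun i hi ↦ posPart_eq_self.2 (sub_nonneg.2 (hc i hi).1.1),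
      ← Finset.sum_congr rfl fun i hi ↦ posPart_eq_self.2 (sub_nonneg.2 (hc i hi).2.1), h]
  have hsquare : ∑ i ∈ s, (u i - -c) ^ 2 / 2 = ∑ i ∈ s, (v i - -c) ^ 2 / 2 := by
    rw [← Finset.sum_congr rfl fun i hi ↦ intervalIntegral_posPart_sub (hc i hi).1,
      ← Finset.sum_congr rfl fun i hi ↦ intervalIntegral_posPart_sub (hc i hi).2,
      ← intervalIntegral.integral_finsetSum, ← intervalIntegral.integral_finsetSum]
    · simp only [h]
    all_goals exact fun i _ ↦ Continuous.intervalIntegrable (by fun_prop) _ _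
  have hexpand (a : ℝ) : a ^ 2 = 2 * ((a - -c) ^ 2 / 2) - 2 * c * (a - -c) + c ^ 2 := by ring
  rw [Finset.sum_congr rfl fun i _ ↦ hexpand (u i), Finset.sum_congr rfl fun i _ ↦ hexpand (v i)]
  simp only [Finset.sum_add_distrib, Finset.sum_sub_distrib, ← Finset.mul_sum, hsquare, hlinear]

theorem sum_perm_gren_sq (n : ℕ) (x : ℕ → ℝ) :
    ∑ σ : permBelow n, ∑ j ∈ Finset.range n, gren n (fun i ↦ x (σ.1 i)) j ^ 2 =
      ∑ σ : permBelow n, ∑ j ∈ Finset.range n,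
        ((∑ i ∈ Finset.range (j + 1), x (σ.1 i)) / (j + 1)) ^ 2 := by
  rw [← Finset.sum_product', ← Finset.sum_product']
  refine sum_sq_eq_of_sum_posPart_sub_eq _
    (fun q : permBelow n × ℕ ↦ gren n (fun i ↦ x (q.1.1 i)) q.2)
    (fun q ↦ (∑ i ∈ Finset.range (q.2 + 1), x (q.1.1 i)) / (q.2 + 1)) fun t ↦ ?_
  simp only [Finset.sum_product, sum_range_posPart_gren_sub]
  rw [sum_perm_maxPartialSum le_rfl fun i ↦ x i - t]
  refine Finset.sum_congr rfl fun σ _ ↦ Finset.sum_congr rfl fun j _ ↦ ?_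
  have hj : (0 : ℝ) < j + 1 := by positivity
  rw [Finset.sum_sub_distrib, Finset.sum_const, Finset.card_range, nsmul_eq_mul, posPart_def,
    posPart_def, ← max_div_div_right hj.le, zero_div, sub_div, Nat.cast_add_one,
    mul_div_cancel_left₀ t hj.ne']

end PosPart

section Exchangeable

variable {Ω : Type*} [MeasurableSpace Ω] {P : Measure Ω} {X : ℕ → Ω → ℝ} {n : ℕ}

/-- The law of the sequence `X` is invariant under the permutations of its first `n` entries. This
is exchangeability of `X 0, …, X (n - 1)`, stated for the whole sequence so that `gren n` and the
permutations act on one space. -/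
def IsExchangeableBelow (X : ℕ → Ω → ℝ) (n : ℕ) (P : Measure Ω) : Prop :=
  ∀ σ ∈ permBelow n, IdentDistrib (fun ω i ↦ X (σ i) ω) (fun ω i ↦ X i ω) P P

theorem IsExchangeableBelow.integral_sum_perm (hX : IsExchangeableBelow X n P)
    {F : (ℕ → ℝ) → ℝ} (hF : Measurable F) (hFX : Integrable (fun ω ↦ F (X · ω)) P) :
    ∫ ω, ∑ σ : permBelow n, F (fun i ↦ X (σ.1 i) ω) ∂P =
      Fintype.card (permBelow n) * ∫ ω, F (X · ω) ∂P := by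
  have hident (σ : permBelow n) :
      IdentDistrib (fun ω ↦ F fun i ↦ X (σ.1 i) ω) (fun ω ↦ F (X · ω)) P P :=
    (hX σ σ.2).comp hF
  rw [integral_finsetSum _ fun σ _ ↦ (hident σ).integrable_iff.2 hFX,
    Finset.sum_congr rfl fun σ _ ↦ (hident σ).integral_eq, Finset.sum_const, Finset.card_univ,
    nsmul_eq_mul]

theorem IsExchangeableBelow.integral_eq_of_sum_perm_eq (hX : IsExchangeableBelow X n P)
    {F G : (ℕ → ℝ) → ℝ} (hF : Measurable F) (hG : Measurable G)
    (hFX : Integrable (fun ω ↦ F (X · ω)) P) (hGX : Integrable (fun ω ↦ G (X · ω)) P)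
    (hFG : ∀ x : ℕ → ℝ, ∑ σ : permBelow n, F (fun i ↦ x (σ.1 i)) =
      ∑ σ : permBelow n, G (fun i ↦ x (σ.1 i))) :
    ∫ ω, F (X · ω) ∂P = ∫ ω, G (X · ω) ∂P := by
  have hcard : (Fintype.card (permBelow n) : ℝ) ≠ 0 := Nat.cast_ne_zero.2 Fintype.card_ne_zero
  apply mul_left_cancel₀ hcard
  rw [← hX.integral_sum_perm hF hFX, ← hX.integral_sum_perm hG hGX]
  exact congrArg (integral P) (funext fun ω ↦ hFG (X · ω))

theorem memLp_gren {q : ENNReal} (hX : ∀ i, MemLp (X i) q P) {j : ℕ} (hj : j < n) :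
    MemLp (fun ω ↦ gren n (X · ω) j) q P := by
  have hmeas : AEMeasurable (fun ω i ↦ X i ω) P := aemeasurable_pi_lambda _ fun i ↦
    (hX i).aestronglyMeasurable.aemeasurable
  refine ((memLp_finsetSum (Finset.range n) fun i _ ↦ (hX i).abs).const_mul 2).mono'
    ((continuous_gren hj).measurable.comp_aemeasurable hmeas).aestronglyMeasurable ?_
  exact ae_of_all _ fun ω ↦ abs_gren_le (X · ω) hj

theorem IsExchangeableBelow.sum_integral_gren_sq (hX : IsExchangeableBelow X n P)
    (hX2 : ∀ i, MemLp (X i) 2 P) :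
    ∑ j ∈ Finset.range n, ∫ ω, gren n (X · ω) j ^ 2 ∂P =
      ∑ j ∈ Finset.range n, ∫ ω, ((∑ i ∈ Finset.range (j + 1), X i ω) / (j + 1)) ^ 2 ∂P := by
  have hgren : ∀ j ∈ Finset.range n, Integrable (fun ω ↦ gren n (X · ω) j ^ 2) P := fun j hj ↦
    (memLp_gren hX2 (Finset.mem_range.1 hj)).integrable_sq
  have hmean : ∀ j ∈ Finset.range n,
      Integrable (fun ω ↦ ((∑ i ∈ Finset.range (j + 1), X i ω) / (j + 1)) ^ 2) P := fun j _ ↦ by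
    simpa only [div_eq_mul_inv] using
      ((memLp_finsetSum (Finset.range (j + 1)) fun i _ ↦ hX2 i).mul_const
        ((j : ℝ) + 1)⁻¹).integrable_sq
  rw [← integral_finsetSum _ hgren, ← integral_finsetSum _ hmean]
  refine hX.integral_eq_of_sum_perm_eq
    (F := fun x ↦ ∑ j ∈ Finset.range n, gren n x j ^ 2)
    (G := fun x ↦ ∑ j ∈ Finset.range n, ((∑ i ∈ Finset.range (j + 1), x i) / (j + 1)) ^ 2)
    ?_ ?_ (integrable_finsetSum _ hgren) (integrable_finsetSum _ hmean) (sum_perm_gren_sq n)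
  · exact Finset.measurable_sum _ fun j hj ↦
      (continuous_gren (Finset.mem_range.1 hj)).measurable.pow_const 2
  · fun_prop

theorem IsExchangeableBelow.sum_integral_gren_sq_of_integral_sum_sq
    (hX : IsExchangeableBelow X n P) (hX2 : ∀ i, MemLp (X i) 2 P) {c θ : ℝ}
    (hvar : ∀ m ≤ n, ∫ ω, (∑ i ∈ Finset.range m, X i ω) ^ 2 ∂P = c * (m * θ - (m * θ) ^ 2)) :
    ∑ j ∈ Finset.range n, ∫ ω, gren n (X · ω) j ^ 2 ∂P =
      c * ∑ j ∈ Finset.Icc 1 n, θ * (1 / (j : ℝ) - θ) := by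
  rw [hX.sum_integral_gren_sq hX2, Finset.mul_sum, ← Finset.Ico_add_one_right_eq_Icc,
    Finset.sum_Ico_eq_sum_range]
  refine Finset.sum_congr rfl fun j hj ↦ ?_
  simp only [div_pow, integral_div]
  rw [hvar (j + 1) (Finset.mem_range.1 hj)]
  push_cast
  field_simp
  ring

end Exchangeable

section Gaussian

variable {Ω Ω' : Type*} [MeasurableSpace Ω] [MeasurableSpace Ω'] {P : Measure Ω} {P' : Measure Ω'}

section Vector

variable {ι : Type*} [Fintype ι] [DecidableEq ι]

theorem strongDual_pi_apply_eq_sum (L : StrongDual ℝ (ι → ℝ)) (v : ι → ℝ) :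
    L v = ∑ i, L (Pi.single i 1) * v i := by
  conv_lhs => rw [pi_eq_sum_univ' v, map_sum]
  refine Finset.sum_congr rfl fun i _ ↦ ?_
  rw [map_smul, smul_eq_mul, mul_comm]

theorem integral_strongDual_pi {X : ι → Ω → ℝ} (hX : ∀ i, Integrable (X i) P)
    (L : StrongDual ℝ (ι → ℝ)) :
    ∫ ω, L (X · ω) ∂P = ∑ i, L (Pi.single i 1) * ∫ ω, X i ω ∂P := by
  simp_rw [strongDual_pi_apply_eq_sum L (X · _)]
  rw [integral_finsetSum _ fun i _ ↦ (hX i).const_mul _]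
  simp_rw [integral_const_mul]

theorem variance_strongDual_pi [IsFiniteMeasure P] {X : ι → Ω → ℝ}
    (hX : ∀ i, MemLp (X i) 2 P) (L : StrongDual ℝ (ι → ℝ)) :
    Var[fun ω ↦ L (X · ω); P] =
      ∑ i, ∑ j, L (Pi.single i 1) * (L (Pi.single j 1) * cov[X i, X j; P]) := by
  simp_rw [strongDual_pi_apply_eq_sum L (X · _)]
  rw [variance_fun_sum' fun i _ ↦ (hX i).const_mul _]
  simp_rw [covariance_const_mul_left, covariance_const_mul_right]

end Vector

theorem identDistrib_of_hasGaussianLaw {ι : Type*} [Finite ι] {X : ι → Ω → ℝ}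
    {X' : ι → Ω' → ℝ}
    (hX : HasGaussianLaw (fun ω i ↦ X i ω) P) (hX' : HasGaussianLaw (fun ω i ↦ X' i ω) P')
    (hmean : ∀ i, ∫ ω, X i ω ∂P = ∫ ω, X' i ω ∂P')
    (hcov : ∀ i j, cov[X i, X j; P] = cov[X' i, X' j; P']) :
    IdentDistrib (fun ω i ↦ X i ω) (fun ω i ↦ X' i ω) P P' where
  aemeasurable_fst := hX.aemeasurable
  aemeasurable_snd := hX'.aemeasurable
  map_eq := by
    classical
    have := Fintype.ofFinite ι
    have := hX.isProbabilityMeasure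
    have := hX'.isProbabilityMeasure
    have := hX.isGaussian_map
    have := hX'.isGaussian_map
    have hX2 (i : ι) : MemLp (X i) 2 P := (hX.map_fun (ContinuousLinearMap.proj i)).memLp_two
    have hX'2 (i : ι) : MemLp (X' i) 2 P' := (hX'.map_fun (ContinuousLinearMap.proj i)).memLp_two
    refine Measure.ext_of_charFunDual (funext fun L ↦ ?_)
    rw [hX.charFunDual_map_eq_fun, hX'.charFunDual_map_eq_fun,
      integral_strongDual_pi (fun i ↦ (hX2 i).integrable one_le_two),
      integral_strongDual_pi (fun i ↦ (hX'2 i).integrable one_le_two),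
      variance_strongDual_pi hX2, variance_strongDual_pi hX'2]
    simp_rw [hmean, hcov]

theorem identDistrib_of_isGaussianProcess {T : Type*} [Countable T] {X X' : T → Ω → ℝ}
    (hX : IsGaussianProcess X P) (hX' : IsGaussianProcess X' P)
    (hmean : ∀ t, ∫ ω, X t ω ∂P = ∫ ω, X' t ω ∂P)
    (hcov : ∀ s t, cov[X s, X t; P] = cov[X' s, X' t; P]) :
    IdentDistrib (fun ω t ↦ X t ω) (fun ω t ↦ X' t ω) P P := by
  have := hX.isProbabilityMeasure
  refine (identDistrib_iff_forall_finset_identDistrib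
    (aemeasurable_pi_lambda _ hX.aemeasurable) (aemeasurable_pi_lambda _ hX'.aemeasurable)).2
    fun I ↦ ?_
  exact identDistrib_of_hasGaussianLaw (X := fun i : I ↦ X i) (X' := fun i : I ↦ X' i)
    (hX.hasGaussianLaw I) (hX'.hasGaussianLaw I) (fun i ↦ hmean i) fun i j ↦ hcov i j

namespace IsLimitProcess

variable {p : ℕ → ℝ} {Y : ℕ → Ω → ℝ}

theorem memLp (hY : IsLimitProcess p Y P) (x : ℕ) : MemLp (Y x) 2 P :=
  (hY.gaussian.hasGaussianLaw_eval x).memLp_two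

theorem isExchangeableBelow (hY : IsLimitProcess p Y P) {r n : ℕ} {θ : ℝ}
    (hp : ∀ i < n, p (r + i) = θ) : IsExchangeableBelow (fun i ↦ Y (r + i)) n P := by
  intro σ hσ
  have hpσ (i : ℕ) : p (r + σ i) = p (r + i) := by
    rcases lt_or_ge i n with hi | hi
    · rw [hp i hi, hp (σ i) (apply_lt_of_mem_permBelow hσ hi)]
    · rw [mem_permBelow_iff.1 hσ i hi]
  refine identDistrib_of_isGaussianProcess (hY.gaussian.comp_right fun i ↦ r + σ i)
    (hY.gaussian.comp_right fun i ↦ r + i) (fun i ↦ ?_) fun i j ↦ ?_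
  · simp only [hY.mean]
  · simp only [hY.cov, hpσ, Nat.add_left_cancel_iff, σ.injective.eq_iff]

theorem integral_sum_sq (hY : IsLimitProcess p Y P) {r m : ℕ} {θ : ℝ}
    (hp : ∀ i < m, p (r + i) = θ) :
    ∫ ω, (∑ i ∈ Finset.range m, Y (r + i) ω) ^ 2 ∂P = m * θ - (m * θ) ^ 2 := by
  have := hY.gaussian.isProbabilityMeasure
  have hmean : ∫ ω, ∑ i ∈ Finset.range m, Y (r + i) ω ∂P = 0 := by
    rw [integral_finsetSum _ fun i _ ↦ (hY.memLp _).integrable one_le_two]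
    simp [hY.mean]
  have hcov : ∀ i ∈ Finset.range m, ∀ j ∈ Finset.range m,
      cov[Y (r + i), Y (r + j); P] = (if i = j then θ else 0) - θ ^ 2 := fun i hi j hj ↦ by
    rw [hY.cov, hp i (Finset.mem_range.1 hi), hp j (Finset.mem_range.1 hj), sq]
    simp only [Nat.add_left_cancel_iff]
  calc ∫ ω, (∑ i ∈ Finset.range m, Y (r + i) ω) ^ 2 ∂P
      = ∑ i ∈ Finset.range m, ∑ j ∈ Finset.range m, cov[Y (r + i), Y (r + j); P] := by
        rw [← variance_of_integral_eq_zero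
          (memLp_finsetSum _ fun i _ ↦ hY.memLp _).aemeasurable hmean,
          variance_fun_sum' fun i _ ↦ hY.memLp _]
    _ = ∑ i ∈ Finset.range m, ∑ j ∈ Finset.range m, ((if i = j then θ else 0) - θ ^ 2) :=
        Finset.sum_congr rfl fun i hi ↦ Finset.sum_congr rfl (hcov i hi)
    _ = ∑ i ∈ Finset.range m, (θ - m * θ ^ 2) := by
        refine Finset.sum_congr rfl fun i hi ↦ ?_
        simp [Finset.sum_sub_distrib, Finset.mem_range.1 hi]
    _ = m * θ - (m * θ) ^ 2 := by
        rw [Finset.sum_const, Finset.card_range, nsmul_eq_mul]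
        ring

end IsLimitProcess

end Gaussian

section Series

variable {Ω ι : Type*} [MeasurableSpace Ω] {P : Measure Ω}

theorem tsum_lintegral_enorm_ne_top {E : Type*} [NormedAddCommGroup E] {f : ι → Ω → E}
    (hf : ∀ i, Integrable (f i) P) (hs : Summable fun i ↦ ∫ ω, ‖f i ω‖ ∂P) :
    ∑' i, ∫⁻ ω, ‖f i ω‖ₑ ∂P ≠ ⊤ := by
  simp_rw [← fun i ↦ ofReal_integral_norm_eq_lintegral_enorm (hf i)]
  exact hs.tsum_ofReal_ne_top

variable [Countable ι]

theorem ae_summable_of_summable_integral_norm {E : Type*} [NormedAddCommGroup E] [CompleteSpace E]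
    {f : ι → Ω → E} (hf : ∀ i, Integrable (f i) P) (hs : Summable fun i ↦ ∫ ω, ‖f i ω‖ ∂P) :
    ∀ᵐ ω ∂P, Summable fun i ↦ f i ω := by
  have h := summable_norm_of_tsum_eLpNorm_ne_top le_rfl (fun i ↦ (hf i).1) <| by
    simpa only [eLpNorm_one_eq_lintegral_enorm] using tsum_lintegral_enorm_ne_top hf hs
  exact h.mono fun ω hω ↦ hω.of_norm

theorem integrable_tsum_of_summable_integral_norm {f : ι → Ω → ℝ}
    (hf : ∀ i, Integrable (f i) P) (hs : Summable fun i ↦ ∫ ω, ‖f i ω‖ ∂P) :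
    Integrable (fun ω ↦ ∑' i, f i ω) P := by
  refine ⟨(AEMeasurable.tsum fun i ↦ (hf i).1.aemeasurable).aestronglyMeasurable, ?_⟩
  calc ∫⁻ ω, ‖∑' i, f i ω‖ₑ ∂P
      ≤ ∫⁻ ω, ∑' i, ‖f i ω‖ₑ ∂P := lintegral_mono fun ω ↦ enorm_tsum_le_tsum_enorm
    _ = ∑' i, ∫⁻ ω, ‖f i ω‖ₑ ∂P := lintegral_tsum fun i ↦ (hf i).1.enorm
    _ < ⊤ := (tsum_lintegral_enorm_ne_top hf hs).lt_top

end Series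

section Periods

variable {p : ℕ → ℝ}

theorem eq_of_constancyPeriod_eq_Ico {x r n : ℕ} (h : constancyPeriod p x = Set.Ico r (r + n))
    {i : ℕ} (hi : i < n) : p (r + i) = p x := by
  have hmem : r + i ∈ constancyPeriod p x := by rw [h, Set.mem_Ico]; lia
  exact hmem

theorem grenTransform_of_constancyPeriod_eq_Ico {x r n : ℕ}
    (h : constancyPeriod p x = Set.Ico r (r + n)) {j : ℕ} (hj : j < n) (y : ℕ → ℝ) :
    grenTransform p y (r + j) = gren n (fun i ↦ y (r + i)) j := by
  have hperiod : constancyPeriod p (r + j) = Set.Ico r (r + n) := by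
    rw [← h, constancyPeriod, constancyPeriod, eq_of_constancyPeriod_eq_Ico h hj]
  have hInf : sInf (Set.Ico r (r + n)) = r := csInf_Ico (by lia)
  have hSup : sSup (Set.Ico r (r + n)) = r + n - 1 :=
    IsGreatest.csSup_eq ⟨by rw [Set.mem_Ico]; lia, fun z hz ↦ Nat.le_sub_one_of_lt hz.2⟩
  rw [grenTransform, hperiod, if_pos (Set.finite_Ico _ _), hInf, hSup,
    show r + n - 1 + 1 - r = n by lia, Nat.add_sub_cancel_left]

namespace IsDecreasingPMF

theorem constancyPeriod_finite (hp : IsDecreasingPMF p) {x : ℕ} (hx : 0 < p x) :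
    (constancyPeriod p x).Finite := by
  have h := hp.hasSum_one.summable.tendsto_cofinite_zero.eventually (gt_mem_nhds hx)
  exact h.subset fun z hz ↦ not_lt.2 (ge_of_eq hz)

theorem constancyPeriod_infinite (hp : IsDecreasingPMF p) {x : ℕ} (hx : p x = 0) :
    (constancyPeriod p x).Infinite :=
  (Set.Ici_infinite x).mono fun z hz ↦
    le_antisymm (hp.antitone hz) (hx.trans_le (hp.nonneg z))

theorem grenTransform_of_eq_zero (hp : IsDecreasingPMF p) {x : ℕ} (hx : p x = 0) (y : ℕ → ℝ) :
    grenTransform p y x = y x :=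
  if_neg (hp.constancyPeriod_infinite hx)

theorem constancyPeriod_eq_Ico (hp : IsDecreasingPMF p) {x : ℕ} (hx : 0 < p x) :
    ∃ r n : ℕ, constancyPeriod p x = Set.Ico r (r + n) := by
  have hfin := hp.constancyPeriod_finite hx
  have hord : (constancyPeriod p x).OrdConnected := ⟨fun a ha b hb z hz ↦
    le_antisymm ((hp.antitone hz.1).trans_eq ha) ((ge_of_eq hb).trans (hp.antitone hz.2))⟩
  have hInf : p (sInf (constancyPeriod p x)) = p x :=
    Nat.sInf_mem (s := constancyPeriod p x) ⟨x, rfl⟩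
  have hSup : p (sSup (constancyPeriod p x)) = p x :=
    Nat.sSup_mem (s := constancyPeriod p x) ⟨x, rfl⟩ hfin.bddAbove
  have hle := Nat.sInf_le (s := constancyPeriod p x) hSup
  refine ⟨sInf (constancyPeriod p x),
    sSup (constancyPeriod p x) + 1 - sInf (constancyPeriod p x), subset_antisymm ?_ ?_⟩
  · intro z hz
    have := Nat.sInf_le hz
    have := le_csSup hfin.bddAbove hz
    rw [Set.mem_Ico]
    lia
  · exact fun z hz ↦ hord.out hInf hSup ⟨hz.1, by have := hz.2; lia⟩

end IsDecreasingPMF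

end Periods

namespace IsLimitProcess

variable {Ω : Type*} [MeasurableSpace Ω] {P : Measure Ω} {p : ℕ → ℝ} {Y : ℕ → Ω → ℝ}

theorem ae_eq_zero (hY : IsLimitProcess p Y P) {x : ℕ} (hx : p x = 0) :
    ∀ᵐ ω ∂P, Y x ω = 0 := by
  have h := hY.cov x x
  rw [covariance_self (hY.memLp x).aemeasurable, if_pos rfl, hx,
    variance_of_integral_eq_zero (hY.memLp x).aemeasurable (hY.mean x),
    mul_zero, sub_zero, integral_eq_zero_iff_of_nonneg (fun _ ↦ sq_nonneg _)
      (hY.memLp x).integrable_sq] at h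
  exact h.mono fun ω hω ↦ pow_eq_zero_iff two_ne_zero |>.1 hω

theorem integrable_grenTransform_sq (hY : IsLimitProcess p Y P) (hp : IsDecreasingPMF p) (x : ℕ) :
    Integrable (fun ω ↦ grenTransform p (Y · ω) x ^ 2) P := by
  rcases (hp.nonneg x).eq_or_lt with hx | hx
  · simp_rw [hp.grenTransform_of_eq_zero hx.symm]
    exact (hY.memLp x).integrable_sq
  · obtain ⟨r, n, h⟩ := hp.constancyPeriod_eq_Ico hx
    have hxmem : x ∈ Set.Ico r (r + n) := h ▸ rfl
    obtain ⟨j, rfl⟩ := Nat.exists_eq_add_of_le hxmem.1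
    have hj : j < n := Nat.add_lt_add_iff_left.1 hxmem.2
    simp_rw [grenTransform_of_constancyPeriod_eq_Ico h hj]
    exact (memLp_gren (fun i ↦ hY.memLp (r + i)) hj).integrable_sq

theorem integral_grenTransform_sq_of_eq_zero (hY : IsLimitProcess p Y P) (hp : IsDecreasingPMF p)
    {x : ℕ} (hx : p x = 0) : ∫ ω, grenTransform p (Y · ω) x ^ 2 ∂P = 0 := by
  simp_rw [hp.grenTransform_of_eq_zero hx]
  refine integral_eq_zero_of_ae ((hY.ae_eq_zero hx).mono fun ω hω ↦ ?_)
  simp [hω]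

theorem sum_integral_grenTransform_sq_of_constancyPeriod_eq_Ico (hY : IsLimitProcess p Y P)
    {x r n : ℕ} (h : constancyPeriod p x = Set.Ico r (r + n)) :
    ∑ z ∈ Finset.Ico r (r + n), ∫ ω, grenTransform p (Y · ω) z ^ 2 ∂P =
      ∑ j ∈ Finset.Icc 1 n, p x * (1 / (j : ℝ) - p x) := by
  have hconst : ∀ i < n, p (r + i) = p x := fun i ↦ eq_of_constancyPeriod_eq_Ico h
  calc ∑ z ∈ Finset.Ico r (r + n), ∫ ω, grenTransform p (Y · ω) z ^ 2 ∂P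
      = ∑ j ∈ Finset.range n, ∫ ω, gren n (fun i ↦ Y (r + i) ω) j ^ 2 ∂P := by
        rw [Finset.sum_Ico_eq_sum_range, Nat.add_sub_cancel_left]
        refine Finset.sum_congr rfl fun j hj ↦ ?_
        simp_rw [grenTransform_of_constancyPeriod_eq_Ico h (Finset.mem_range.1 hj)]
    _ = 1 * ∑ j ∈ Finset.Icc 1 n, p x * (1 / (j : ℝ) - p x) :=
        (hY.isExchangeableBelow hconst).sum_integral_gren_sq_of_integral_sum_sq
          (fun i ↦ hY.memLp (r + i)) fun m hm ↦ by
            rw [one_mul, hY.integral_sum_sq fun i hi ↦ hconst i (hi.trans_le hm)]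
    _ = ∑ j ∈ Finset.Icc 1 n, p x * (1 / (j : ℝ) - p x) := one_mul _

theorem hasSum_integral_grenTransform_sq_constancyPeriod (hY : IsLimitProcess p Y P)
    (hp : IsDecreasingPMF p) (x : ℕ) :
    HasSum (fun z : constancyPeriod p x ↦ ∫ ω, grenTransform p (Y · ω) z ^ 2 ∂P)
      (∑ j ∈ Finset.Icc 1 (constancyPeriod p x).ncard, p x * (1 / (j : ℝ) - p x)) := by
  rcases (hp.nonneg x).eq_or_lt with hx | hx
  · simp only [← hx, zero_mul, Finset.sum_const_zero]
    convert! hasSum_zero with z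
    exact hY.integral_grenTransform_sq_of_eq_zero hp (Eq.trans z.2 hx.symm)
  · obtain ⟨r, n, h⟩ := hp.constancyPeriod_eq_Ico hx
    have hcard : (Set.Ico r (r + n)).ncard = n := by
      rw [← Finset.coe_Ico, Set.ncard_coe_finset, Nat.card_Ico, Nat.add_sub_cancel_left]
    have hsum := (Finset.Ico r (r + n)).hasSum fun z ↦ ∫ ω, grenTransform p (Y · ω) z ^ 2 ∂P
    rw [hY.sum_integral_grenTransform_sq_of_constancyPeriod_eq_Ico h, Finset.coe_Ico] at hsum
    rwa [h, hcard]

end IsLimitProcess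

namespace IsConstancyDecomposition

variable {p : ℕ → ℝ} {I : Set ℕ} {C : ℕ → Set ℕ} {θ : ℕ → ℝ}

theorem strictAntiOn (hC : IsConstancyDecomposition p I C θ) : StrictAntiOn θ I :=
  have := hC.isLowerSet.ordConnected
  strictAntiOn_of_succ_lt this fun i _ _ hi ↦ hC.strictAnti i hi

theorem existsUnique_mem (hC : IsConstancyDecomposition p I C θ) (x : ℕ) :
    ∃! i : I, x ∈ C i := by
  have hx : x ∈ ⋃ i ∈ I, C i := hC.cover ▸ Set.mem_univ x
  obtain ⟨i, hi, hxi⟩ := Set.mem_iUnion₂.1 hx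
  exact ⟨⟨i, hi⟩, hxi, fun j hxj ↦ Subtype.ext (hC.disjoint.elim_set j.2 hi x hxj hxi)⟩

theorem eq_constancyPeriod (hC : IsConstancyDecomposition p I C θ) {i x : ℕ} (hi : i ∈ I)
    (hx : x ∈ C i) : C i = constancyPeriod p x := by
  refine subset_antisymm (fun z hz ↦ (hC.value i hi z hz).trans (hC.value i hi x hx).symm)
    fun z hz ↦ ?_
  obtain ⟨⟨j, hj⟩, hzj : z ∈ C j, -⟩ := hC.existsUnique_mem z
  have hθ : θ j = θ i := by
    rw [← hC.value j hj z hzj, ← hC.value i hi x hx]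
    exact hz
  rwa [← hC.strictAntiOn.injOn hj hi hθ]

theorem nonneg (hC : IsConstancyDecomposition p I C θ) (hp : IsDecreasingPMF p) {i : ℕ}
    (hi : i ∈ I) : 0 ≤ θ i := by
  obtain ⟨x, hx⟩ := hC.nonempty i hi
  exact hC.value i hi x hx ▸ hp.nonneg x

theorem hasSum_of_hasSum (hC : IsConstancyDecomposition p I C θ) {e : ℕ → ℝ} {b : I → ℝ} {T : ℝ}
    (he : HasSum e T) (hb : ∀ i : I, HasSum (fun z : C i ↦ e z) (b i)) : HasSum b T :=
  ((Set.sigmaEquiv (fun i : I ↦ C i) hC.existsUnique_mem).hasSum_iff.2 he).sigma hb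

theorem summable_ncard_mul (hC : IsConstancyDecomposition p I C θ) (hp : IsDecreasingPMF p) :
    Summable fun i : I ↦ (C i).ncard * θ i := by
  refine ((summable_partition hp.nonneg hC.existsUnique_mem).1 hp.hasSum_one.summable).2.congr
    fun i ↦ ?_
  calc ∑' z : C i, p z
      = ∑' _ : C i, θ i := tsum_congr fun z ↦ hC.value i i.2 z z.2
    _ = (C i).ncard * θ i := by rw [tsum_const, Nat.card_coe_set_eq, nsmul_eq_mul]

end IsConstancyDecomposition

theorem sum_Icc_one_mul_inv_sub_le {θ : ℝ} (hθ : 0 ≤ θ) (n : ℕ) :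
    ∑ j ∈ Finset.Icc 1 n, θ * (1 / (j : ℝ) - θ) ≤ n * θ :=
  calc ∑ j ∈ Finset.Icc 1 n, θ * (1 / (j : ℝ) - θ)
      ≤ ∑ _j ∈ Finset.Icc 1 n, θ := Finset.sum_le_sum fun j _ ↦
        mul_le_of_le_one_right hθ (by rw [one_div]; linarith [Nat.cast_inv_le_one (α := ℝ) j])
    _ = n * θ := by simp

namespace IsLimitProcess

variable {Ω : Type*} [MeasurableSpace Ω] {P : Measure Ω} {p : ℕ → ℝ} {Y : ℕ → Ω → ℝ}
  {I : Set ℕ} {C : ℕ → Set ℕ} {θ : ℕ → ℝ}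

theorem hasSum_integral_grenTransform_sq_of_isConstancyDecomposition (hY : IsLimitProcess p Y P)
    (hp : IsDecreasingPMF p) (hC : IsConstancyDecomposition p I C θ) (i : I) :
    HasSum (fun z : C i ↦ ∫ ω, grenTransform p (Y · ω) z ^ 2 ∂P)
      (∑ j ∈ Finset.Icc 1 (C i).ncard, θ i * (1 / (j : ℝ) - θ i)) := by
  obtain ⟨x, hx⟩ := hC.nonempty i i.2
  rw [hC.eq_constancyPeriod i.2 hx, ← hC.value i i.2 x hx]
  exact hY.hasSum_integral_grenTransform_sq_constancyPeriod hp x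

theorem summable_integral_grenTransform_sq (hY : IsLimitProcess p Y P) (hp : IsDecreasingPMF p)
    (hC : IsConstancyDecomposition p I C θ) :
    Summable fun x ↦ ∫ ω, grenTransform p (Y · ω) x ^ 2 ∂P := by
  have hnonneg (x : ℕ) : 0 ≤ ∫ ω, grenTransform p (Y · ω) x ^ 2 ∂P :=
    integral_nonneg fun _ ↦ sq_nonneg _
  have hblock := hY.hasSum_integral_grenTransform_sq_of_isConstancyDecomposition hp hC
  refine (summable_partition hnonneg hC.existsUnique_mem).2 ⟨fun i ↦ (hblock i).summable, ?_⟩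
  refine (hC.summable_ncard_mul hp).of_nonneg_of_le (fun i ↦ tsum_nonneg fun z ↦ hnonneg z)
    fun i ↦ ?_
  rw [(hblock i).tsum_eq]
  exact sum_Icc_one_mul_inv_sub_le (hC.nonneg hp i.2) _

theorem summable_integral_norm_grenTransform_sq (hY : IsLimitProcess p Y P)
    (hp : IsDecreasingPMF p) (hC : IsConstancyDecomposition p I C θ) :
    Summable fun x ↦ ∫ ω, ‖grenTransform p (Y · ω) x ^ 2‖ ∂P := by
  simpa only [Real.norm_of_nonneg (sq_nonneg _)] using hY.summable_integral_grenTransform_sq hp hC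

theorem hasSum_integral_tsum_grenTransform_sq (hY : IsLimitProcess p Y P)
    (hp : IsDecreasingPMF p) (hC : IsConstancyDecomposition p I C θ) :
    HasSum (fun i : I ↦ ∑ j ∈ Finset.Icc 1 (C i).ncard, θ i * (1 / (j : ℝ) - θ i))
      (∫ ω, ∑' x, grenTransform p (Y · ω) x ^ 2 ∂P) :=
  hC.hasSum_of_hasSum
    (hasSum_integral_of_summable_integral_norm (hY.integrable_grenTransform_sq hp)
      (hY.summable_integral_norm_grenTransform_sq hp hC))
    (hY.hasSum_integral_grenTransform_sq_of_isConstancyDecomposition hp hC)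

theorem integrable_sum_grenTransform_sq_div (hY : IsLimitProcess p Y P) (hp : IsDecreasingPMF p)
    (s : Finset ℕ) :
    Integrable (fun ω ↦ ∑ x ∈ s, grenTransform p (Y · ω) x ^ 2 / p x) P :=
  integrable_finsetSum _ fun x _ ↦ (hY.integrable_grenTransform_sq hp x).div_const _

theorem hasSum_integral_grenTransform_sq_div (hY : IsLimitProcess p Y P) (hp : IsDecreasingPMF p)
    {s : Finset ℕ} (hs : ∀ x ∉ s, p x = 0) :
    HasSum (fun x ↦ (∫ ω, grenTransform p (Y · ω) x ^ 2 ∂P) / p x)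
      (∫ ω, ∑ x ∈ s, grenTransform p (Y · ω) x ^ 2 / p x ∂P) := by
  rw [integral_finsetSum _ fun x _ ↦ (hY.integrable_grenTransform_sq hp x).div_const _]
  simp_rw [integral_div]
  exact hasSum_sum_of_ne_finset_zero fun x hx ↦ by rw [hs x hx, div_zero]

theorem hasSum_integral_sum_grenTransform_sq_div (hY : IsLimitProcess p Y P)
    (hp : IsDecreasingPMF p) (hC : IsConstancyDecomposition p I C θ) {s : Finset ℕ}
    (hs : ∀ x ∉ s, p x = 0) :
    HasSum (fun i : {i // i ∈ I ∧ 0 < θ i} ↦ ∑ j ∈ Finset.Icc 1 (C i).ncard, (1 / (j : ℝ) - θ i))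
      (∫ ω, ∑ x ∈ s, grenTransform p (Y · ω) x ^ 2 / p x ∂P) := by
  have hblock : ∀ i : I, HasSum (fun z : C i ↦ (∫ ω, grenTransform p (Y · ω) z ^ 2 ∂P) / p z)
      ((∑ j ∈ Finset.Icc 1 (C i).ncard, θ i * (1 / (j : ℝ) - θ i)) / θ i) := fun i ↦ by
    simp_rw [fun z : C i ↦ hC.value i i.2 z z.2]
    exact (hY.hasSum_integral_grenTransform_sq_of_isConstancyDecomposition hp hC i).div_const (θ i)
  have hsum := hC.hasSum_of_hasSum (hY.hasSum_integral_grenTransform_sq_div hp hs) hblock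
  let f : {i // i ∈ I ∧ 0 < θ i} → I := fun i ↦ ⟨i, i.2.1⟩
  have hf : Function.Injective f := fun i j hij ↦ Subtype.ext (Subtype.mk.inj hij)
  have hzero : ∀ i ∉ Set.range f,
      (∑ j ∈ Finset.Icc 1 (C i).ncard, θ i * (1 / (j : ℝ) - θ i)) / θ i = 0 := fun i hi ↦ by
    have hθ : θ i = 0 := le_antisymm (not_lt.1 fun hpos ↦ hi ⟨⟨i, i.2, hpos⟩, rfl⟩)
      (hC.nonneg hp i.2)
    rw [hθ, div_zero]
  convert! (hf.hasSum_iff hzero).2 hsum using 2 with i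
  simp only [f, Function.comp_apply, ← Finset.mul_sum, mul_div_cancel_left₀ _ i.2.2.ne']

end IsLimitProcess

section Indicator

variable {α : Type*} [MeasurableSpace α] {μ : Measure α} {A : Set α}

theorem memLp_indicator_one [IsFiniteMeasure μ] (hA : MeasurableSet A) (q : ENNReal) :
    MemLp (A.indicator (1 : α → ℝ)) q μ :=
  (memLp_const 1).indicator hA

theorem variance_indicator_one [IsProbabilityMeasure μ] (hA : MeasurableSet A) :
    Var[A.indicator 1; μ] = μ.real A - μ.real A ^ 2 := by
  have hsq : A.indicator (1 : α → ℝ) ^ 2 = A.indicator 1 := by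
    ext a
    by_cases ha : a ∈ A <;> simp [ha]
  rw [variance_eq_sub (memLp_indicator_one hA 2), hsq, integral_indicator_one hA]

end Indicator

section MassLaw

variable {p : ℕ → ℝ}

theorem massLaw_singleton (p : ℕ → ℝ) (x : ℕ) : massLaw p {x} = ENNReal.ofReal (p x) :=
  Measure.sum_smul_dirac_singleton

theorem IsDecreasingPMF.isProbabilityMeasure_massLaw (hp : IsDecreasingPMF p) :
    IsProbabilityMeasure (massLaw p) :=
  hp.hasSum_one.isProbabilityMeasure_sum_dirac hp.nonneg

theorem IsDecreasingPMF.massLaw_real_finset (hp : IsDecreasingPMF p) (A : Finset ℕ) :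
    (massLaw p).real A = ∑ x ∈ A, p x := by
  have := hp.isProbabilityMeasure_massLaw
  rw [← sum_measureReal_singleton]
  refine Finset.sum_congr rfl fun x _ ↦ ?_
  rw [measureReal_def, massLaw_singleton, ENNReal.toReal_ofReal (hp.nonneg x)]

theorem measurePreserving_massLaw {σ : Equiv.Perm ℕ} (hσ : ∀ x, p (σ x) = p x) :
    MeasurePreserving σ.symm (massLaw p) (massLaw p) := by
  refine ⟨measurable_of_countable _, Measure.ext_of_singleton fun x ↦ ?_⟩
  rw [Measure.map_apply (measurable_of_countable _) (measurableSet_singleton x),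
    ← Equiv.image_eq_preimage_symm, Set.image_singleton, massLaw_singleton, massLaw_singleton, hσ]

end MassLaw

section Sample

variable {n : ℕ}

theorem empiricalMass_nonneg (X : Fin n → ℕ) (x : ℕ) : 0 ≤ empiricalMass X x :=
  div_nonneg (Finset.sum_nonneg fun _ _ ↦ ite_nonneg zero_le_one le_rfl) n.cast_nonneg

theorem empiricalMass_le_one (X : Fin n → ℕ) (x : ℕ) : empiricalMass X x ≤ 1 := by
  refine div_le_one_of_le₀ ?_ n.cast_nonneg
  calc ∑ i, (if X i = x then (1 : ℝ) else 0)
      ≤ ∑ _i : Fin n, (1 : ℝ) := Finset.sum_le_sum fun i _ ↦ by split_ifs <;> norm_num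
    _ = n := by simp

theorem empiricalMass_of_sup_lt {X : Fin n → ℕ} {x : ℕ} (hx : Finset.univ.sup X < x) :
    empiricalMass X x = 0 := by
  have hne (i : Fin n) : X i ≠ x := ((Finset.le_sup (Finset.mem_univ i)).trans_lt hx).ne
  simp [empiricalMass, hne]

theorem empiricalMass_symm_comp (σ : Equiv.Perm ℕ) (X : Fin n → ℕ) (x : ℕ) :
    empiricalMass (fun k ↦ σ.symm (X k)) x = empiricalMass X (σ x) := by
  simp only [empiricalMass, Equiv.symm_apply_eq]

theorem sum_empiricalMass (X : Fin n → ℕ) (A : Finset ℕ) :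
    ∑ x ∈ A, empiricalMass X x = (∑ k, (A : Set ℕ).indicator 1 (X k)) / n := by
  simp only [empiricalMass, ← Finset.sum_div]
  rw [Finset.sum_comm]
  simp [Set.indicator_apply]

section Moments

variable {ν : Measure ℕ}

theorem memLp_empiricalMass_sub [IsFiniteMeasure ν] (q : ENNReal) (c : ℝ) (x : ℕ) :
    MemLp (fun X : Fin n → ℕ ↦ empiricalMass X x - c) q (Measure.pi fun _ ↦ ν) := by
  refine MemLp.of_bound (measurable_of_countable _).aestronglyMeasurable (1 + |c|)
    (ae_of_all _ fun X ↦ (norm_sub_le _ _).trans ?_)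
  rw [Real.norm_of_nonneg (empiricalMass_nonneg X x), Real.norm_eq_abs]
  gcongr
  exact empiricalMass_le_one X x

variable [IsProbabilityMeasure ν]

theorem integral_sum_empiricalMass (hn : n ≠ 0) (A : Finset ℕ) :
    ∫ X : Fin n → ℕ, ∑ x ∈ A, empiricalMass X x ∂(Measure.pi fun _ ↦ ν) = ν.real A := by
  have hA : MeasurableSet (A : Set ℕ) := A.measurableSet
  simp_rw [sum_empiricalMass]
  rw [integral_div, integral_finsetSum _ fun k _ ↦
    integrable_comp_eval ((memLp_indicator_one hA 1).integrable le_rfl)]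
  simp_rw [integral_comp_eval (μ := fun _ : Fin n ↦ ν)
    (memLp_indicator_one hA 1).aestronglyMeasurable, integral_indicator_one hA]
  rw [Finset.sum_const, Finset.card_univ, Fintype.card_fin, nsmul_eq_mul,
    mul_div_cancel_left₀ _ (Nat.cast_ne_zero.2 hn)]

theorem variance_sum_empiricalMass (hn : n ≠ 0) (A : Finset ℕ) :
    Var[fun X : Fin n → ℕ ↦ ∑ x ∈ A, empiricalMass X x; Measure.pi fun _ ↦ ν] =
      (ν.real A - ν.real A ^ 2) / n := by
  have hsum := variance_sum_pi (μ := fun _ : Fin n ↦ ν) (X := fun _ ↦ (A : Set ℕ).indicator 1)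
    fun _ ↦ memLp_indicator_one A.measurableSet 2
  simp only [variance_indicator_one A.measurableSet, Finset.sum_const, Finset.card_univ,
    Fintype.card_fin, nsmul_eq_mul] at hsum
  simp_rw [sum_empiricalMass, div_eq_mul_inv]
  rw [variance_mul_const, ← Finset.sum_fn, hsum]
  field_simp

theorem integral_sum_empiricalMass_sub_sq (hn : n ≠ 0) (A : Finset ℕ) :
    ∫ X : Fin n → ℕ, (∑ x ∈ A, empiricalMass X x - ν.real A) ^ 2 ∂(Measure.pi fun _ ↦ ν) =
      1 / n * (ν.real A - ν.real A ^ 2) := by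
  rw [one_div_mul_eq_div, ← variance_sum_empiricalMass hn A,
    variance_eq_integral (measurable_of_countable _).aemeasurable,
    integral_sum_empiricalMass hn A]

end Moments

namespace IsDecreasingPMF

variable {p : ℕ → ℝ} {m : ℕ} {θ : ℝ}

theorem isExchangeableBelow_empiricalMass_sub (hp : IsDecreasingPMF p) (n : ℕ)
    (hθ : ∀ x < m, p x = θ) :
    IsExchangeableBelow (fun x (X : Fin n → ℕ) ↦ empiricalMass X x - p x) m
      (Measure.pi fun _ ↦ massLaw p) := by
  intro σ hσ
  have := hp.isProbabilityMeasure_massLaw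
  have hpσ (x : ℕ) : p (σ x) = p x := by
    rcases lt_or_ge x m with hx | hx
    · rw [hθ x hx, hθ (σ x) (apply_lt_of_mem_permBelow hσ hx)]
    · rw [mem_permBelow_iff.1 hσ x hx]
  have hrelabel := measurePreserving_pi (fun _ : Fin n ↦ massLaw p) (fun _ : Fin n ↦ massLaw p)
    fun _ ↦ measurePreserving_massLaw hpσ
  have hmeas : Measurable fun (X : Fin n → ℕ) x ↦ empiricalMass X x - p x :=
    measurable_of_countable _
  refine ⟨(measurable_of_countable _).aemeasurable, hmeas.aemeasurable, ?_⟩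
  conv_rhs => rw [← hrelabel.map_eq, Measure.map_map hmeas hrelabel.measurable]
  congr 1
  funext X x
  simp only [Function.comp_apply, empiricalMass_symm_comp, hpσ]

theorem sum_integral_gren_empiricalMass_sub_sq (hp : IsDecreasingPMF p) (hn : n ≠ 0)
    (hθ : ∀ x < m, p x = θ) :
    ∑ j ∈ Finset.range m, ∫ X : Fin n → ℕ, gren m (fun x ↦ empiricalMass X x - p x) j ^ 2
        ∂(Measure.pi fun _ ↦ massLaw p) =
      1 / n * ∑ j ∈ Finset.Icc 1 m, θ * (1 / (j : ℝ) - θ) := by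
  have := hp.isProbabilityMeasure_massLaw
  refine (hp.isExchangeableBelow_empiricalMass_sub n hθ).sum_integral_gren_sq_of_integral_sum_sq
    (fun x ↦ memLp_empiricalMass_sub 2 (p x) x) fun k hk ↦ ?_
  have hreal : (massLaw p).real (Finset.range k) = k * θ := by
    rw [hp.massLaw_real_finset, Finset.sum_congr rfl fun x hx ↦
      hθ x ((Finset.mem_range.1 hx).trans_le hk), Finset.sum_const, Finset.card_range, nsmul_eq_mul]
  simp_rw [Finset.sum_sub_distrib]
  rw [← hp.massLaw_real_finset, integral_sum_empiricalMass_sub_sq hn, hreal]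

end IsDecreasingPMF

end Sample

section Uniform

variable {n y : ℕ}

theorem uniformMass_of_le {x : ℕ} (hx : x ≤ y) : uniformMass y x = 1 / ((y : ℝ) + 1) :=
  if_pos hx

theorem uniformMass_of_lt {x : ℕ} (hx : y < x) : uniformMass y x = 0 :=
  if_neg hx.not_ge

theorem uniformMass_nonneg (y x : ℕ) : 0 ≤ uniformMass y x :=
  ite_nonneg (by positivity) le_rfl

theorem isDecreasingPMF_uniformMass (y : ℕ) : IsDecreasingPMF (uniformMass y) where
  nonneg := uniformMass_nonneg y
  hasSum_one := by
    have hsum : ∑ x ∈ Finset.range (y + 1), uniformMass y x = 1 := by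
      rw [Finset.sum_congr rfl fun x hx ↦ uniformMass_of_le (Finset.mem_range_succ_iff.1 hx),
        Finset.sum_const, Finset.card_range, nsmul_eq_mul, Nat.cast_add_one,
        mul_one_div_cancel (Nat.cast_add_one_ne_zero y)]
    rw [← hsum]
    exact hasSum_sum_of_ne_finset_zero fun x hx ↦
      uniformMass_of_lt (by rwa [Finset.mem_range_succ_iff, not_le] at hx)
  antitone x z hxz := by
    rcases le_or_gt z y with hz | hz
    · rw [uniformMass_of_le hz, uniformMass_of_le (hxz.trans hz)]
    · exact (uniformMass_of_lt hz).trans_le (uniformMass_nonneg y x)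

theorem isConstancyDecomposition_uniformMass (y : ℕ) :
    IsConstancyDecomposition (uniformMass y) (Set.Iio 2)
      (fun i ↦ if i = 0 then Set.Iic y else Set.Ioi y)
      (fun i ↦ if i = 0 then 1 / ((y : ℝ) + 1) else 0) where
  isLowerSet := isLowerSet_Iio 2
  nonempty i _ := by
    split_ifs
    exacts [Set.nonempty_Iic, Set.nonempty_Ioi]
  disjoint i hi j hj hij := by
    rw [Set.mem_Iio] at hi hj
    rw [Function.onFun, Set.disjoint_left]
    interval_cases i <;> interval_cases j <;> simp at hij ⊢
  cover := by
    refine Set.eq_univ_of_forall fun x ↦ Set.mem_iUnion₂.2 ?_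
    rcases le_or_gt x y with hx | hx
    exacts [⟨0, Set.mem_Iio.2 zero_lt_two, hx⟩, ⟨1, Set.mem_Iio.2 one_lt_two, hx⟩]
  value i _ x hx := by
    split_ifs at hx ⊢
    exacts [uniformMass_of_le hx, uniformMass_of_lt hx]
  strictAnti i hi := by
    obtain rfl : i = 0 := by rw [Set.mem_Iio] at hi; lia
    simp only [zero_add, one_ne_zero, if_false, if_true]
    positivity

theorem sum_Icc_inv_sub_inv_add_one (y : ℕ) :
    ∑ j ∈ Finset.Icc 1 (y + 1), 1 / ((y : ℝ) + 1) * (1 / (j : ℝ) - 1 / ((y : ℝ) + 1)) =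
      1 / ((y : ℝ) + 1) * ∑ i ∈ Finset.Icc 1 y, 1 / ((i : ℝ) + 1) := by
  have hshift : ∑ j ∈ Finset.Icc 1 (y + 1), 1 / (j : ℝ) =
      1 + ∑ i ∈ Finset.Icc 1 y, 1 / ((i : ℝ) + 1) := by
    rw [← Finset.Ico_add_one_right_eq_Icc, Finset.sum_eq_sum_Ico_succ_bot (by lia),
      ← Finset.sum_Ico_add' (fun j : ℕ ↦ 1 / (j : ℝ)), Finset.Ico_add_one_right_eq_Icc]
    push_cast
    rw [div_one]
  rw [← Finset.mul_sum, Finset.sum_sub_distrib, hshift, Finset.sum_const, Nat.card_Icc,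
    nsmul_eq_mul]
  push_cast
  field_simp
  ring

theorem IsLimitProcess.integral_tsum_grenTransform_uniformMass_sq {Ω : Type*} [MeasurableSpace Ω]
    {P : Measure Ω} {Y : ℕ → Ω → ℝ} (hY : IsLimitProcess (uniformMass y) Y P) :
    ∫ ω, ∑' x, grenTransform (uniformMass y) (Y · ω) x ^ 2 ∂P =
      1 / ((y : ℝ) + 1) * ∑ i ∈ Finset.Icc 1 y, 1 / ((i : ℝ) + 1) := by
  have hcard : (Set.Iic y).ncard = y + 1 := by
    rw [← Finset.coe_Iic, Set.ncard_coe_finset, Nat.card_Iic]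
  refine (hY.hasSum_integral_tsum_grenTransform_sq (isDecreasingPMF_uniformMass y)
    (isConstancyDecomposition_uniformMass y)).unique ?_
  rw [← sum_Icc_inv_sub_inv_add_one, ← hcard]
  refine hasSum_single (⟨0, Set.mem_Iio.2 zero_lt_two⟩ : Set.Iio 2) fun i hi ↦ ?_
  have hi0 : (i : ℕ) ≠ 0 := fun h ↦ hi (Subtype.ext h)
  simp [hi0]

theorem grenanderEstimator_eq_gren {X : Fin n → ℕ} (hX : ∀ k, X k ≤ y) {x : ℕ} (hx : x ≤ y) :
    grenanderEstimator X x = gren (y + 1) (empiricalMass X) x := by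
  rw [gren_eq_ite_of_eventually_zero (n := Finset.univ.sup X + 1)
    (Nat.add_le_add_right (Finset.sup_le fun k _ ↦ hX k) 1) (empiricalMass_nonneg X)
    (fun i ↦ empiricalMass_of_sup_lt) (Nat.lt_add_one_iff.2 hx), grenanderEstimator]
  simp only [Nat.lt_add_one_iff]

theorem grenanderEstimator_of_lt {X : Fin n → ℕ} (hX : ∀ k, X k ≤ y) {x : ℕ} (hx : y < x) :
    grenanderEstimator X x = 0 :=
  if_neg ((Finset.sup_le fun k _ ↦ hX k).trans_lt hx).not_ge

theorem tsum_grenanderEstimator_sub_uniformMass_sq {X : Fin n → ℕ} (hX : ∀ k, X k ≤ y) :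
    ∑' x, (grenanderEstimator X x - uniformMass y x) ^ 2 =
      ∑ j ∈ Finset.range (y + 1),
        gren (y + 1) (fun x ↦ empiricalMass X x - uniformMass y x) j ^ 2 := by
  rw [tsum_eq_sum (s := Finset.range (y + 1))]
  · refine Finset.sum_congr rfl fun j hj ↦ ?_
    have hjy := Finset.mem_range_succ_iff.1 hj
    rw [grenanderEstimator_eq_gren hX hjy, uniformMass_of_le hjy,
      ← gren_sub_const _ _ (Finset.mem_range.1 hj)]
    congr 1
    exact gren_congr (fun i hi ↦ by rw [uniformMass_of_le (Nat.lt_add_one_iff.1 hi)])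
      (Finset.mem_range.1 hj)
  · intro x hx
    rw [Finset.mem_range_succ_iff, not_le] at hx
    rw [grenanderEstimator_of_lt hX hx, uniformMass_of_lt hx, sub_zero, zero_pow two_ne_zero]

theorem ae_forall_le_of_uniformMass (y n : ℕ) :
    ∀ᵐ X : Fin n → ℕ ∂Measure.pi fun _ ↦ massLaw (uniformMass y), ∀ k, X k ≤ y := by
  have := (isDecreasingPMF_uniformMass y).isProbabilityMeasure_massLaw
  have hle : ∀ᵐ x ∂massLaw (uniformMass y), x ≤ y := by
    rw [ae_iff_of_countable]
    intro x hx
    contrapose! hx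
    rw [massLaw_singleton, uniformMass_of_lt hx, ENNReal.ofReal_zero]
  exact ae_all_iff.2 fun k ↦
    (Measure.tendsto_eval_ae_ae (μ := fun _ : Fin n ↦ massLaw (uniformMass y))).eventually hle

theorem grenanderRisk_uniformMass (y : ℕ) (hn : n ≠ 0) :
    n * grenanderRisk (uniformMass y) n =
      1 / ((y : ℝ) + 1) * ∑ i ∈ Finset.Icc 1 y, 1 / ((i : ℝ) + 1) := by
  have hp := isDecreasingPMF_uniformMass y
  have := hp.isProbabilityMeasure_massLaw
  rw [grenanderRisk, integral_congr_ae ((ae_forall_le_of_uniformMass y n).mono fun X hX ↦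
      tsum_grenanderEstimator_sub_uniformMass_sq hX),
    integral_finsetSum _ fun j hj ↦ (memLp_gren (fun x ↦ memLp_empiricalMass_sub 2 _ x)
      (Finset.mem_range.1 hj)).integrable_sq,
    hp.sum_integral_gren_empiricalMass_sub_sq hn fun x hx ↦
      uniformMass_of_le (Nat.lt_add_one_iff.1 hx),
    ← mul_assoc, mul_one_div_cancel (Nat.cast_ne_zero.2 hn), one_mul, sum_Icc_inv_sub_inv_add_one]

end Uniform

section Asymptotics

theorem sum_Icc_one_div_add_one_eq_harmonic (y : ℕ) :
    ∑ i ∈ Finset.Icc 1 y, 1 / ((i : ℝ) + 1) = harmonic y + (1 / ((y : ℝ) + 1) - 1) := by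
  induction y with
  | zero => simp
  | succ y ih =>
    rw [Finset.sum_Icc_succ_top (by lia), ih, harmonic_succ]
    push_cast
    ring

theorem sum_Icc_one_div_add_one_isEquivalent_log :
    (fun y : ℕ ↦ ∑ i ∈ Finset.Icc 1 y, 1 / ((i : ℝ) + 1)) ~[atTop] fun y : ℕ ↦ Real.log y := by
  have hdiff : Tendsto (fun y : ℕ ↦ ∑ i ∈ Finset.Icc 1 y, 1 / ((i : ℝ) + 1) - Real.log y) atTop
      (𝓝 (Real.eulerMascheroniConstant + (0 - 1))) := by
    refine (Real.tendsto_harmonic_sub_log.add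
      ((tendsto_one_div_add_atTop_nhds_zero_nat (𝕜 := ℝ)).sub_const 1)).congr fun y ↦ ?_
    rw [sum_Icc_one_div_add_one_eq_harmonic]
    ring
  have hlog : Tendsto (fun y : ℕ ↦ Real.log y) atTop atTop :=
    Real.tendsto_log_atTop.comp tendsto_natCast_atTop_atTop
  exact (hdiff.isBigO_one ℝ).trans_isLittleO
    (isLittleO_const_left.2 (Or.inr (tendsto_norm_atTop_atTop.comp hlog)))

theorem average_one_div_add_one_isEquivalent_log_div :
    (fun y : ℕ ↦ 1 / ((y : ℝ) + 1) * ∑ i ∈ Finset.Icc 1 y, 1 / ((i : ℝ) + 1)) ~[atTop]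
      fun y : ℕ ↦ Real.log y / ((y : ℝ) + 1) := by
  simp_rw [one_div_mul_eq_div]
  exact sum_Icc_one_div_add_one_isEquivalent_log.div .refl

end Asymptotics

theorem IsDecreasingPMF.eq_zero_of_isGreatest {p : ℕ → ℝ} (hp : IsDecreasingPMF p) {κ : ℕ}
    (hκ : IsGreatest {x | 0 < p x} κ) {x : ℕ} (hx : x ∉ Finset.range (κ + 1)) : p x = 0 :=
  le_antisymm (not_lt.1 fun hpos ↦ hx (Finset.mem_range_succ_iff.2 (hκ.2 hpos))) (hp.nonneg x)

theorem mainTheorem3 :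
    -- the formulas for a general decreasing mass function
    (∀ (Ω : Type*) [MeasurableSpace Ω] (P : Measure Ω) [IsProbabilityMeasure P]
        (p : ℕ → ℝ) (Y : ℕ → Ω → ℝ) (I : Set ℕ) (C : ℕ → Set ℕ) (θ : ℕ → ℝ),
        IsDecreasingPMF p → IsLimitProcess p Y P → IsConstancyDecomposition p I C θ →
        -- the squared `ℓ²` norm; `C i` is infinite only if `θ i = 0`, when its term is zero
        ((∀ᵐ ω ∂P, Summable fun x ↦ grenTransform p (Y · ω) x ^ 2) ∧
          Integrable (fun ω ↦ ∑' x, grenTransform p (Y · ω) x ^ 2) P ∧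
          HasSum (fun i : I ↦ ∑ j ∈ Finset.Icc 1 (C i).ncard, θ i * (1 / (j : ℝ) - θ i))
            (∫ ω, ∑' x, grenTransform p (Y · ω) x ^ 2 ∂P)) ∧
        -- the Hellinger-type functional, when the support of `p` is `{0, …, κ}`
        (∀ κ : ℕ, IsGreatest {x | 0 < p x} κ →
          Integrable (fun ω ↦ ∑ x ∈ Finset.range (κ + 1), grenTransform p (Y · ω) x ^ 2 / p x) P ∧
          HasSum (fun i : {i // i ∈ I ∧ 0 < θ i} ↦
              ∑ j ∈ Finset.Icc 1 (C i).ncard, (1 / (j : ℝ) - θ i))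
            (∫ ω, ∑ x ∈ Finset.range (κ + 1), grenTransform p (Y · ω) x ^ 2 / p x ∂P))) ∧
    -- the asymptotic risk of the maximum likelihood estimator under a uniform mass function
    (∃ a : ℕ → ℝ,
      (∀ y, a y = 1 / ((y : ℝ) + 1) * ∑ i ∈ Finset.Icc 1 y, 1 / ((i : ℝ) + 1)) ∧
      (∀ y, Tendsto (fun n : ℕ ↦ (n : ℝ) * grenanderRisk (uniformMass y) n) atTop (𝓝 (a y))) ∧
      (∀ (Ω : Type*) [MeasurableSpace Ω] (P : Measure Ω) [IsProbabilityMeasure P]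
        (Y : ℕ → Ω → ℝ) (y : ℕ), IsLimitProcess (uniformMass y) Y P →
        ∫ ω, ∑' x, grenTransform (uniformMass y) (Y · ω) x ^ 2 ∂P = a y) ∧
      a ~[atTop] fun y : ℕ ↦ Real.log y / ((y : ℝ) + 1)) := by
  refine ⟨fun Ω _ P _ p Y I C θ hp hY hC ↦ ⟨?_, fun κ hκ ↦ ?_⟩,
    fun y ↦ 1 / ((y : ℝ) + 1) * ∑ i ∈ Finset.Icc 1 y, 1 / ((i : ℝ) + 1), fun _ ↦ rfl, fun y ↦ ?_,
    fun Ω _ P _ Y y hY ↦ hY.integral_tsum_grenTransform_uniformMass_sq,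
    average_one_div_add_one_isEquivalent_log_div⟩
  · have hint := hY.integrable_grenTransform_sq hp
    have hsum := hY.summable_integral_norm_grenTransform_sq hp hC
    exact ⟨ae_summable_of_summable_integral_norm hint hsum,
      integrable_tsum_of_summable_integral_norm hint hsum,
      hY.hasSum_integral_tsum_grenTransform_sq hp hC⟩
  · exact ⟨hY.integrable_sum_grenTransform_sq_div hp _,
      hY.hasSum_integral_sum_grenTransform_sq_div hp hC fun x ↦ hp.eq_zero_of_isGreatest hκ⟩
  · refine tendsto_const_nhds.congr' ?_
    filter_upwards [eventually_ne_atTop 0] with n hn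
    exact (grenanderRisk_uniformMass y hn).symm
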